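/- **Effective Hamiltonians in different Landau levels.** Let $B>0$, $m>0$, and let $$H=\frac1{2m}(\pi_x^2+\pi_y^2),\qquad \pi_x=-\mathrm i\partial_x+\tfrac12By,\quad \pi_y=-\mathrm i\partial_y-\tfrac12Bx,$$ be the Landau Hamiltonian on $L^2(\mathbb R^2)$, with eigenvalues $\epsilon_n=(n+\tfrac12)B/m$, $n=0,1,2,\dots$. Let $n\mathrm{LL}\subset L^2(\mathbb R^2)$ be the eigenspace for $\epsilon_n$ (the $n$-th Landau level) and let $n\mathrm{LL}^N\subset L^2_{\rm asym}(\mathbb R^{2N})$ be its $N$-fold antisymmetric tensor power (the closed span of the Slater determinants of functions in $n\mathrm{LL}$); write $\mathrm{LLL}^N$ for $n=0$, and let $\Pi_n^N$ be the orthogonal projector onto $n\mathrm{LL}^N$. Potentials are tempered distributions, $V,w\in\mathcal S'(\mathbb R^2)$ and $W\in\mathcal S'(\mathbb R^{2\ell})$ with $\ell\ge 0$, and derivatives of potentials are taken in the sense of distributions. Put $$H_{V,w}=\sum_{i=1}^N\bigl[H^{(i)}+V(\mathbf r_i)\bigr]+\sum_{i<j}w(\mathbf r_i-\mathbf r_j),\qquad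 H_{V,W}=\sum_{i=1}^N\bigl[H^{(i)}+V(\mathbf r_i)\bigr]+\sum_{i_1<\dots<i_\ell}W(\mathbf r_{i_1},\dots,\mathbf r_{i_\ell}),$$ as maps from $\mathcal S(\mathbb R^{2N})$ to $\mathcal S'(\mathbb R^{2N})$. The projected Hamiltonian $\Pi_n^N H_{V,w}\Pi_n^N$ is the closure of the operator in $n\mathrm{LL}^N$ which maps a Schwartz function $\Psi\in n\mathrm{LL}^N$ to the vector $\Xi\in n\mathrm{LL}^N$ (if there is one) with $\langle\Phi,\Xi\rangle=\langle\Phi,H_{V,w}\Psi\rangle$ for all Schwartz functions $\Phi\in n\mathrm{LL}^N$; similarly for $H_{V,W}$. Let $L_n(t)=\sum_{l=0}^n\binom nl\frac{(-t)^l}{l!}$ be the $n$-th Laguerre polynomial, and define $$V^{(n)}=L_n\Bigl(-\frac{\Delta}{2B}\Bigr)V,\qquad w^{(n)}=L_n\Bigl(-\frac{\Delta}{2B}\Bigr)^2w,\qquad W^{(n)}=\prod_{i=1}^{\ell}L_n\Bigl(-\frac{\Delta_{i}}{2B}\Bigr)W,$$ where $\Delta_i$ is the Laplacian in the $i$-th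 position variable. (For $B=2$ these operators are $L_n(-\frac14\Delta)$, $L_n(-\frac14\Delta)^2$ and $\prod_i L_n(-\frac14\Delta_i)$.) Then for all $n,N\ge0$ there is a unitary map $U:n\mathrm{LL}^N\to\mathrm{LLL}^N$, independent of the potentials, such that the Schwartz functions are dense in $n\mathrm{LL}^N$, $U$ maps the Schwartz functions in $n\mathrm{LL}^N$ onto those in $\mathrm{LLL}^N$, and for all $V$ and $w$ $$U\Bigl(\Pi_n^N H_{V,w}\Pi_n^N-n\,\tfrac Bm\,N\Bigr)U^{-1}=\Pi_0^N H_{V^{(n)},w^{(n)}}\Pi_0^N ,$$ both as (closed) operators and for the matrix elements between Schwartz functions; in the same sense, for all $V$, all $\ell\ge 0$ and all $\ell$-particle interactions $W$, $$U\Bigl(\Pi_n^N H_{V,W}\Pi_n^N-n\,\tfrac Bm\,N\Bigr)U^{-1}=\Pi_0^N H_{V^{(n)},W^{(n)}}\Pi_0^N .$$ (For $m=\frac12$, i.e. $H=\pi_x^2+\pi_y^2$, the energy shift is $n\cdot 2B\,N$.) -/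

import Mathlib

open MeasureTheory
open scoped SchwartzMap FourierTransform InnerProductSpace LineDeriv Laplacian

namespace LandauLevels

noncomputable section

/-- The plane `ℝ²` with its Euclidean norm and Lebesgue measure. -/
abbrev Plane : Type := EuclideanSpace ℝ (Fin 2)

/-- The configuration space `ℝ^{2N}` of `N` particles in the plane; the coordinates `(i, 0)` and
`(i, 1)` are the `x`- and the `y`-coordinate of the particle `i`. -/
abbrev Config (N : ℕ) : Type := EuclideanSpace ℝ (Fin N × Fin 2)

/-- The linear map that selects the positions of the particles `s 0, …, s (ℓ - 1)`:
`(r_0, …, r_{N-1}) ↦ (r_{s 0}, …, r_{s (ℓ-1)})`. -/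
def select {N ℓ : ℕ} (s : Fin ℓ → Fin N) : Config N →L[ℝ] Config ℓ :=
  LinearMap.toContinuousLinearMap
    { toFun := fun r => WithLp.toLp 2 (fun jk : Fin ℓ × Fin 2 => r (s jk.1, jk.2))
      map_add' := fun _ _ => rfl
      map_smul' := fun _ _ => rfl }

/-- The position `r_i ∈ ℝ²` of the particle `i`. -/
def position {N : ℕ} (i : Fin N) : Config N →L[ℝ] Plane :=
  LinearMap.toContinuousLinearMap
    { toFun := fun r => WithLp.toLp 2 (fun k : Fin 2 => r (i, k))
      map_add' := fun _ _ => rfl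
      map_smul' := fun _ _ => rfl }

/-- The relative position `r_i - r_j ∈ ℝ²` of two particles. -/
def relPosition {N : ℕ} (i j : Fin N) : Config N →L[ℝ] Plane :=
  position i - position j

@[simp] lemma select_apply {N ℓ : ℕ} (s : Fin ℓ → Fin N) (r : Config N) (j : Fin ℓ) (k : Fin 2) :
    select s r (j, k) = r (s j, k) := rfl

@[simp] lemma position_apply {N : ℕ} (i : Fin N) (r : Config N) (k : Fin 2) :
    position i r k = r (i, k) := rfl

@[simp] lemma relPosition_apply {N : ℕ} (i j : Fin N) (r : Config N) (k : Fin 2) :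
    relPosition i j r k = r (i, k) - r (j, k) := rfl

lemma select_surjective {N ℓ : ℕ} {s : Fin ℓ → Fin N} (hs : Function.Injective s) :
    Function.Surjective (select s) := by
  classical
  intro q
  refine ⟨WithLp.toLp 2 (fun ik : Fin N × Fin 2 =>
    if h : ∃ j, s j = ik.1 then q (h.choose, ik.2) else 0), ?_⟩
  ext ⟨j, k⟩
  have h : ∃ j', s j' = s j := ⟨j, rfl⟩
  have hj : h.choose = j := hs h.choose_spec
  simp only [select_apply]
  rw [dif_pos h, hj]

lemma position_surjective {N : ℕ} (i : Fin N) : Function.Surjective (position i) := by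
  intro q
  refine ⟨WithLp.toLp 2 (fun ik : Fin N × Fin 2 => q ik.2), ?_⟩
  ext k
  simp

lemma relPosition_surjective {N : ℕ} {i j : Fin N} (hij : i ≠ j) :
    Function.Surjective (relPosition i j) := by
  intro q
  refine ⟨WithLp.toLp 2 (fun ik : Fin N × Fin 2 => if ik.1 = i then q ik.2 else 0), ?_⟩
  ext k
  simp [hij.symm]

/-! ### Pulling back tempered distributions along surjective linear maps -/

section Pullback

variable {E F : Type*} [NormedAddCommGroup E] [InnerProductSpace ℝ E] [FiniteDimensional ℝ E]
  [NormedAddCommGroup F] [InnerProductSpace ℝ F] [FiniteDimensional ℝ F]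

lemma exists_antilipschitz_adjoint (A : E →L[ℝ] F) (hA : Function.Surjective A) :
    ∃ K : NNReal, AntilipschitzWith K (ContinuousLinearMap.adjoint A) := by
  have hinj : LinearMap.ker (ContinuousLinearMap.adjoint A).toLinearMap = ⊥ := by
    rw [LinearMap.ker_eq_bot']
    intro y hy
    obtain ⟨x, rfl⟩ := hA y
    have h : ⟪x, ContinuousLinearMap.adjoint A (A x)⟫_ℝ = 0 := by
      have hy' : ContinuousLinearMap.adjoint A (A x) = 0 := hy
      rw [hy', inner_zero_right]
    rw [ContinuousLinearMap.adjoint_inner_right] at h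
    exact inner_self_eq_zero.mp h
  obtain ⟨K, -, hK⟩ := LinearMap.exists_antilipschitzWith _ hinj
  exact ⟨K, hK⟩

variable [MeasurableSpace E] [BorelSpace E] [MeasurableSpace F] [BorelSpace F]

/-- The push-forward `A_* f` of a Schwartz function under a surjective linear map `A`: the density
of the image under `A` of the complex measure `f(x) dx`, so that
`∫ g(y) (A_* f)(y) dy = ∫ g(A x) f(x) dx` (see `integral_mul_pushforward`). For a coordinate
projection it is the marginal, obtained by integrating out the other coordinates.
On the Fourier side it is `f̂ ↦ f̂ ∘ Aᵀ`. -/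
def pushforward (A : E →L[ℝ] F) (hA : Function.Surjective A) : 𝓢(E, ℂ) →L[ℂ] 𝓢(F, ℂ) :=
  FourierTransform.fourierInvCLM ℂ 𝓢(F, ℂ) ∘L
    SchwartzMap.compCLMOfAntilipschitz ℂ
      (ContinuousLinearMap.adjoint A).hasTemperateGrowth
      (exists_antilipschitz_adjoint A hA).choose_spec ∘L
    FourierTransform.fourierCLM ℂ 𝓢(E, ℂ)

/-- The defining property of the push-forward. -/
lemma integral_mul_pushforward (A : E →L[ℝ] F) (hA : Function.Surjective A)
    (f : 𝓢(E, ℂ)) (g : 𝓢(F, ℂ)) :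
    ∫ y, g y * pushforward A hA f y = ∫ x, g (A x) * f x := by
  have h1 : ∫ y, g y * pushforward A hA f y
      = ∫ ξ, 𝓕 (f : E → ℂ) (ContinuousLinearMap.adjoint A ξ) * 𝓕⁻ g ξ := by
    have h := SchwartzMap.integral_fourierInv_mul_eq
      (SchwartzMap.compCLMOfAntilipschitz ℂ
        (ContinuousLinearMap.adjoint A).hasTemperateGrowth
        (exists_antilipschitz_adjoint A hA).choose_spec (𝓕 f)) g
    rw [SchwartzMap.compCLMOfAntilipschitz_apply] at h
    refine Eq.trans ?_ h
    refine integral_congr_ae (Filter.Eventually.of_forall fun y => ?_)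
    exact mul_comm _ _
  rw [h1]
  have h2 := VectorFourier.integral_fourierIntegral_smul_eq_flip
    (e := Real.fourierChar) (μ := (volume : Measure E)) (ν := (volume : Measure F))
    (L := (innerₗ F).comp A.toLinearMap) (f := (f : E → ℂ)) (g := (𝓕⁻ g : 𝓢(F, ℂ)))
    Real.continuous_fourierChar ?_ f.integrable (𝓕⁻ g : 𝓢(F, ℂ)).integrable
  · have h3 : ∀ ξ : F, VectorFourier.fourierIntegral Real.fourierChar (volume : Measure E)
        ((innerₗ F).comp A.toLinearMap) (f : E → ℂ) ξ
        = 𝓕 (f : E → ℂ) (ContinuousLinearMap.adjoint A ξ) := by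
      intro ξ
      simp [VectorFourier.fourierIntegral, Real.fourier_eq,
        ContinuousLinearMap.adjoint_inner_right]
    have h4 : ∀ x : E, VectorFourier.fourierIntegral Real.fourierChar (volume : Measure F)
        ((innerₗ F).comp A.toLinearMap).flip ((𝓕⁻ g : 𝓢(F, ℂ)) : F → ℂ) x = g (A x) := by
      intro x
      have h5 : 𝓕 ((𝓕⁻ g : 𝓢(F, ℂ)) : F → ℂ) (A x) = g (A x) := by
        rw [← SchwartzMap.fourier_coe, FourierTransform.fourier_fourierInv_eq]
      rw [← h5]
      simp [VectorFourier.fourierIntegral, Real.fourier_eq, real_inner_comm]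
    simp only [h3, h4, smul_eq_mul] at h2
    rw [h2]
    exact integral_congr_ae (Filter.Eventually.of_forall fun y => mul_comm _ _)
  · have : Continuous fun p : E × F => (⟪A p.1, p.2⟫_ℝ : ℝ) := by fun_prop
    exact this

/-- The pull-back `V ∘ A` of a tempered distribution under a surjective linear map `A`. -/
def pullback (A : E →L[ℝ] F) (hA : Function.Surjective A) (V : 𝓢'(F, ℂ)) : 𝓢'(E, ℂ) :=
  PointwiseConvergenceCLM.precomp ℂ (pushforward A hA) V

end Pullback

/-! ### The Landau Hamiltonian and the Landau levels -/

/-- The conjugate `φ̄` of a Schwartz function. -/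
def conjSchwartz {E : Type*} [NormedAddCommGroup E] [NormedSpace ℝ E] (φ : 𝓢(E, ℂ)) : 𝓢(E, ℂ) :=
  SchwartzMap.postcompCLM (𝕜 := ℝ) (Complex.conjCLE : ℂ →L[ℝ] ℂ) φ

section Landau

variable {ι : Type*} [Fintype ι] [DecidableEq ι]

/-- `π_x = -i ∂_x + (B/2) y`, where `x` and `y` are the coordinates with the indices `a`, `b`. -/
def kineticX (B : ℝ) (a b : ι) :
    𝓢(EuclideanSpace ℝ ι, ℂ) →L[ℂ] 𝓢(EuclideanSpace ℝ ι, ℂ) :=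
  (-Complex.I) •
      LineDeriv.lineDerivOpCLM ℂ 𝓢(EuclideanSpace ℝ ι, ℂ) (EuclideanSpace.single a (1 : ℝ))
    + ((B / 2 : ℝ) : ℂ) • SchwartzMap.smulLeftCLM ℂ (fun r : EuclideanSpace ℝ ι => (r b : ℂ))

/-- `π_y = -i ∂_y - (B/2) x`, where `x` and `y` are the coordinates with the indices `a`, `b`. -/
def kineticY (B : ℝ) (a b : ι) :
    𝓢(EuclideanSpace ℝ ι, ℂ) →L[ℂ] 𝓢(EuclideanSpace ℝ ι, ℂ) :=
  (-Complex.I) •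
      LineDeriv.lineDerivOpCLM ℂ 𝓢(EuclideanSpace ℝ ι, ℂ) (EuclideanSpace.single b (1 : ℝ))
    - ((B / 2 : ℝ) : ℂ) • SchwartzMap.smulLeftCLM ℂ (fun r : EuclideanSpace ℝ ι => (r a : ℂ))

/-- The Landau Hamiltonian `H = (π_x² + π_y²) / (2m)` in the coordinates with the indices
`a`, `b`, on Schwartz functions (a domain of essential self-adjointness). -/
def landauHamiltonian (B m : ℝ) (a b : ι) :
    𝓢(EuclideanSpace ℝ ι, ℂ) →L[ℂ] 𝓢(EuclideanSpace ℝ ι, ℂ) :=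
  ((1 / (2 * m) : ℝ) : ℂ) •
    (kineticX B a b ∘L kineticX B a b + kineticY B a b ∘L kineticY B a b)

end Landau

/-- The energy `ε_n = (n + 1/2) B / m` of the `n`-th Landau level. -/
def levelEnergy (B m : ℝ) (n : ℕ) : ℝ := (n + 1 / 2) * (B / m)

/-- The `n`-th Landau level: the eigenspace in `L²(ℝ²)` of (the self-adjoint closure of) the Landau
Hamiltonian with the eigenvalue `ε_n`, i.e. `⟨H φ, ψ⟩ = ε_n ⟨φ, ψ⟩` for all Schwartz `φ`. -/
def landauLevel (B m : ℝ) (n : ℕ) : Submodule ℂ (Lp ℂ 2 (volume : Measure Plane)) where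
  carrier := {ψ | ∀ φ : 𝓢(Plane, ℂ),
    ⟪(landauHamiltonian B m 0 1 φ).toLp 2, ψ⟫_ℂ = (levelEnergy B m n : ℂ) * ⟪φ.toLp 2, ψ⟫_ℂ}
  add_mem' := by
    intro ψ χ hψ hχ φ
    rw [inner_add_right, inner_add_right, hψ φ, hχ φ, mul_add]
  zero_mem' := by
    intro φ
    simp
  smul_mem' := by
    intro c ψ hψ φ
    rw [inner_smul_right, inner_smul_right, hψ φ]
    ring

/-- The elements of `L²(ℝ^{2N})` that are Slater determinants `det (ψ_i(r_j))` of one-particle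
states `ψ_0, …, ψ_{N-1}` in the `n`-th Landau level. -/
def slaterStates (B m : ℝ) (n N : ℕ) : Set (Lp ℂ 2 (volume : Measure (Config N))) :=
  {Ψ | ∃ ψ : Fin N → Lp ℂ 2 (volume : Measure Plane), (∀ i, ψ i ∈ landauLevel B m n) ∧
    ∀ᵐ r : Config N, Ψ r = Matrix.det (Matrix.of fun i j : Fin N => ψ i (position j r))}

/-- The `n`-th Landau level of `N` fermions: the antisymmetric tensor power of `landauLevel B m n`,
i.e. the closed linear span of the Slater determinants. -/
def landauLevelN (B m : ℝ) (n N : ℕ) : Submodule ℂ (Lp ℂ 2 (volume : Measure (Config N))) :=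
  (Submodule.span ℂ (slaterStates B m n N)).topologicalClosure

/-! ### The `N`-body Hamiltonian and its projection to a Landau level -/

/-- The multiplication operator `∑_i V(r_i)`, as a tempered distribution on `ℝ^{2N}`. -/
def oneBody (N : ℕ) (V : 𝓢'(Plane, ℂ)) : 𝓢'(Config N, ℂ) :=
  ∑ i : Fin N, pullback (position i) (position_surjective i) V

/-- The multiplication operator `∑_{i<j} w(r_i - r_j)`. -/
def twoBody (N : ℕ) (w : 𝓢'(Plane, ℂ)) : 𝓢'(Config N, ℂ) :=
  ∑ p : {p : Fin N × Fin N // p.1 < p.2},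
    pullback (relPosition p.1.1 p.1.2) (relPosition_surjective p.2.ne) w

/-- The multiplication operator `∑_{i_1 < ⋯ < i_ℓ} W(r_{i_1}, …, r_{i_ℓ})`. -/
def manyBody (N : ℕ) {ℓ : ℕ} (W : 𝓢'(Config ℓ, ℂ)) : 𝓢'(Config N, ℂ) :=
  ∑ s : {s : Fin ℓ → Fin N // StrictMono s}, pullback (select s.1) (select_surjective s.2.injective) W

/-- The `N`-body Hamiltonian `∑_i H^{(i)} + Q` with the total potential `Q`; it maps a Schwartz
function `ψ` to the tempered distribution `∑_i H^{(i)} ψ + Q ψ`. -/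
def hamiltonian (B m : ℝ) {N : ℕ} (Q : 𝓢'(Config N, ℂ)) (ψ : 𝓢(Config N, ℂ)) :
    𝓢'(Config N, ℂ) :=
  ((∑ i : Fin N, landauHamiltonian B m (i, 0) (i, 1) ψ : 𝓢(Config N, ℂ)) : 𝓢'(Config N, ℂ))
    + TemperedDistribution.smulLeftCLM ℂ ψ Q

/-- The matrix element `⟨φ, (∑_i H^{(i)} + Q) ψ⟩`. -/
def matrixElement (B m : ℝ) {N : ℕ} (Q : 𝓢'(Config N, ℂ)) (φ ψ : 𝓢(Config N, ℂ)) : ℂ :=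
  hamiltonian B m Q ψ (conjSchwartz φ)

/-- The graph of the projected Hamiltonian `Π_n^N (∑_i H^{(i)} + Q) Π_n^N` as an operator in the
Hilbert space `landauLevelN B m n N`. The operator is defined on the Schwartz functions `Ψ` in
this space, by `⟨Φ, Ξ⟩ = ⟨Φ, (∑_i H^{(i)} + Q) Ψ⟩` for all Schwartz functions `Φ` in the
space (that is, `Ξ` is the projection of `(∑_i H^{(i)} + Q) Ψ`), and then closed. -/
def projectedHamiltonianGraph (B m : ℝ) (n : ℕ) {N : ℕ} (Q : 𝓢'(Config N, ℂ)) :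
    Set (landauLevelN B m n N × landauLevelN B m n N) :=
  closure {p | ∃ ψ : 𝓢(Config N, ℂ), ψ.toLp 2 = (p.1 : Lp ℂ 2 (volume : Measure (Config N))) ∧
    ∀ φ : 𝓢(Config N, ℂ), φ.toLp 2 volume ∈ landauLevelN B m n N →
      ⟪φ.toLp 2, (p.2 : Lp ℂ 2 (volume : Measure (Config N)))⟫_ℂ = matrixElement B m Q φ ψ}

/-- The elements of `landauLevelN B m n N` that are Schwartz functions. -/
def schwartzStates (B m : ℝ) (n N : ℕ) : Set (landauLevelN B m n N) :=
  {Ψ | ∃ ψ : 𝓢(Config N, ℂ), ψ.toLp 2 = (Ψ : Lp ℂ 2 (volume : Measure (Config N)))}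

/-- `U` transforms `Π_n^N (∑_i H^{(i)} + Q) Π_n^N - c` into `Π_0^N (∑_i H^{(i)} + Q₀) Π_0^N`: this
is stated both for the matrix elements between Schwartz functions and for the (closed) operators
on the Hilbert spaces. -/
def TransformsInto {B m : ℝ} {n N : ℕ}
    (U : landauLevelN B m n N ≃ₗᵢ[ℂ] landauLevelN B m 0 N) (c : ℝ) (Q Q₀ : 𝓢'(Config N, ℂ)) :
    Prop :=
  (∀ (Φ Ψ : landauLevelN B m n N) (φ ψ φ₀ ψ₀ : 𝓢(Config N, ℂ)),
    φ.toLp 2 = (Φ : Lp ℂ 2 (volume : Measure (Config N))) →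
    ψ.toLp 2 = (Ψ : Lp ℂ 2 (volume : Measure (Config N))) →
    φ₀.toLp 2 = (U Φ : Lp ℂ 2 (volume : Measure (Config N))) →
    ψ₀.toLp 2 = (U Ψ : Lp ℂ 2 (volume : Measure (Config N))) →
    matrixElement B m Q φ ψ - (c : ℂ) * ⟪Φ, Ψ⟫_ℂ = matrixElement B m Q₀ φ₀ ψ₀) ∧
  (∀ Ψ Ξ : landauLevelN B m n N,
    (Ψ, Ξ) ∈ projectedHamiltonianGraph B m n Q ↔
      (U Ψ, U (Ξ - (c : ℂ) • Ψ)) ∈ projectedHamiltonianGraph B m 0 Q₀)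

/-! ### The effective potentials -/

/-- The `n`-th Laguerre polynomial `L_n(t) = ∑_{l=0}^n (n choose l) (-t)^l / l!`. -/
def laguerre (n : ℕ) : Polynomial ℂ :=
  ∑ l ∈ Finset.range (n + 1),
    Polynomial.C ((n.choose l : ℂ) * (-1) ^ l / (l.factorial : ℂ)) * Polynomial.X ^ l

/-- The operator `L_n(-Δ/(2B))` on the tempered distributions on the plane; for `B = 2` this is
`L_n(-Δ/4)`. -/
def laguerreLaplacian (B : ℝ) (n : ℕ) : Module.End ℂ 𝓢'(Plane, ℂ) :=
  Polynomial.aeval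
    (((-(1 / (2 * B)) : ℝ) : ℂ) • (LineDeriv.laplacianCLM ℂ Plane 𝓢'(Plane, ℂ)).toLinearMap :
      Module.End ℂ 𝓢'(Plane, ℂ))
    (laguerre n)

/-- The Laplacian `Δ_i` with respect to the position of the particle `i`. -/
def partialLaplacian {ℓ : ℕ} (i : Fin ℓ) : Module.End ℂ 𝓢'(Config ℓ, ℂ) :=
  (∑ k : Fin 2,
    LineDeriv.lineDerivOpCLM ℂ 𝓢'(Config ℓ, ℂ) (EuclideanSpace.single (i, k) (1 : ℝ)) ∘L
      LineDeriv.lineDerivOpCLM ℂ 𝓢'(Config ℓ, ℂ)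
        (EuclideanSpace.single (i, k) (1 : ℝ))).toLinearMap

/-- The operator `∏_{i=1}^ℓ L_n(-Δ_i/(2B))` on the tempered distributions on `ℝ^{2ℓ}` (the factors
commute). -/
def laguerreLaplacianProd (B : ℝ) (n ℓ : ℕ) : Module.End ℂ 𝓢'(Config ℓ, ℂ) :=
  (List.ofFn fun i : Fin ℓ =>
    Polynomial.aeval (((-(1 / (2 * B)) : ℝ) : ℂ) • partialLaplacian i) (laguerre n)).prod

end

end LandauLevels

open LandauLevels

namespace LandauLevels

noncomputable section

/-! ### Position and derivative operators on Schwartz functions -/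

section Operators

variable {E : Type*} [NormedAddCommGroup E] [NormedSpace ℝ E]

/-! Each particle carries a ladder pair `a = (π_x + iπ_y)/√(2B)`, `a†` with `[a, a†] = 1` and `H =
(B/m)(a†a + 1/2)`, so the Schwartz functions of level `n` are the eigenfunctions of `a†a` with
eigenvalue `n`. The unitary is `∏_i (n!)^{-1/2} a_i^n`. The kinetic energy is a scalar on each
level, which gives the shift `n(B/m)N`, and the matrix elements of a potential depend on the states
only through the density `φ̄ψ`.

The heart is an identity for densities. With `D = -i(∂_x + i∂_y)/√(2B)` and `D' = -i(∂_x -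
i∂_y)/√(2B)` one has `D(φ̄ψ) = φ̄·aψ - conj(a†φ)·ψ`, `D'(φ̄ψ) = φ̄·a†ψ - conj(aφ)·ψ` and `D'D =
-Δ/(2B)`. For `f`, `g` in the lowest level the densities of `(a†)^k f` and `(a†)^k g`, divided by
`k!`, therefore obey the three-term recursion of the Laguerre polynomials in `-Δ/(2B)`
(`density_raising_pow`). Applied to one particle after another this gives `density_eq_list_prod`.
Push-forward along `r ↦ r_i`, `r_i - r_j` or `(r_{i_1}, …, r_{i_ℓ})` turns each `Δ_i` into a
Laplacian in the image variables, or into zero if particle `i` does not enter; since `L_n(0) = 1`,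
only the interacting particles leave a factor. A pair leaves `L_n` twice. Duality moves the
operators onto the potential (`oneBody_density`, `twoBody_density`, `manyBody_density`).

The rest is analysis. Schwartz functions are dense in a level defined weakly in `L²`
(`landauLevel_eq_closure`), because the eigenfunctions span all polynomials times a Gaussian and
these are complete (`eq_zero_of_inner_eigenSpan_eq_zero`). Continuity of the tensor product carries
this to Slater determinants (`landauLevelN_eq_closure`). The unitary is extended from the span of
Schwartz Slater determinants, and `toL2_listDown` and `toL2_listUp` show that on every Schwartz
state it is still given by the ladder operators. -/

lemma lineDerivOp_lineDerivOp_comm (v w : E) (f : 𝓢(E, ℂ)) : ∂_{v} (∂_{w} f) = ∂_{w} (∂_{v} f) := by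
  have h (v w : E) (x : E) : ∂_{v} (∂_{w} f) x = fderiv ℝ (fderiv ℝ f) x v w := by
    rw [SchwartzMap.lineDerivOp_apply_eq_fderiv]
    have h1 : ((∂_{w} f : 𝓢(E, ℂ)) : E → ℂ) = fun y => fderiv ℝ f y w := by
      ext y
      rw [SchwartzMap.lineDerivOp_apply_eq_fderiv]
    rw [h1, fderiv_clm_apply]
    · simp
    · exact ((f.smooth 2).fderiv_right (m := 1) (by norm_num)).differentiable (by norm_num) x
    · exact differentiableAt_const w
  ext x
  rw [h, h]
  refine ContDiffAt.isSymmSndFDerivAt (n := 2) (f.smooth 2).contDiffAt ?_ v w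
  simp

@[simp]
lemma conjSchwartz_apply (f : 𝓢(E, ℂ)) (x : E) :
    conjSchwartz f x = (starRingEnd ℂ) (f x) := rfl

/-- The density `φ̄ ψ` of two Schwartz functions. -/
def density (φ ψ : 𝓢(E, ℂ)) : 𝓢(E, ℂ) := SchwartzMap.smulLeftCLM ℂ ψ (conjSchwartz φ)

lemma density_apply (φ ψ : 𝓢(E, ℂ)) (x : E) :
    density φ ψ x = ψ x * (starRingEnd ℂ) (φ x) := by
  rw [density, SchwartzMap.smulLeftCLM_apply_apply ψ.hasTemperateGrowth]
  rfl

lemma density_smul_right (c : ℂ) (φ ψ : 𝓢(E, ℂ)) : density φ (c • ψ) = c • density φ ψ := by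
  ext x
  simp [density_apply, mul_assoc]

lemma density_smul_left (c : ℂ) (φ ψ : 𝓢(E, ℂ)) :
    density (c • φ) ψ = (starRingEnd ℂ) c • density φ ψ := by
  ext x
  simp [density_apply, mul_left_comm]

lemma density_zero_right (φ : 𝓢(E, ℂ)) : density φ 0 = 0 := by
  ext x
  simp [density_apply]

lemma fderiv_conjSchwartz (φ : 𝓢(E, ℂ)) (x v : E) :
    fderiv ℝ (conjSchwartz φ) x v = (starRingEnd ℂ) (fderiv ℝ φ x v) := by
  have h : (conjSchwartz φ : E → ℂ) = (Complex.conjCLE : ℂ →L[ℝ] ℂ) ∘ φ := rfl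
  rw [h, ((Complex.conjCLE : ℂ →L[ℝ] ℂ).hasFDerivAt.comp x (φ.hasFDerivAt x)).fderiv]
  rfl

lemma lineDerivOp_density (v : E) (φ ψ : 𝓢(E, ℂ)) :
    ∂_{v} (density φ ψ) = density φ (∂_{v} ψ) + density (∂_{v} φ) ψ := by
  ext x
  have h : ((density φ ψ : 𝓢(E, ℂ)) : E → ℂ) = fun y => ψ y * conjSchwartz φ y := by
    ext y
    rw [density_apply, conjSchwartz_apply]
  rw [SchwartzMap.lineDerivOp_apply_eq_fderiv, h,
    fderiv_fun_mul ψ.differentiableAt (conjSchwartz φ).differentiableAt]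
  simp only [add_apply, density_apply, SchwartzMap.lineDerivOp_apply_eq_fderiv,
    smul_apply, fderiv_conjSchwartz, conjSchwartz_apply, smul_eq_mul]
  ring

end Operators

section Coordinates

variable {ι : Type*} [Fintype ι]

/-- Multiplication by the coordinate with the index `a`. -/
def coordMul (a : ι) : Module.End ℂ 𝓢(EuclideanSpace ℝ ι, ℂ) :=
  (SchwartzMap.smulLeftCLM ℂ (fun r : EuclideanSpace ℝ ι => (r a : ℂ))).toLinearMap

lemma coord_hasTemperateGrowth (a : ι) :
    Function.HasTemperateGrowth (fun r : EuclideanSpace ℝ ι => (r a : ℂ)) :=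
  (Complex.ofRealCLM ∘L (EuclideanSpace.proj a : EuclideanSpace ℝ ι →L[ℝ] ℝ)).hasTemperateGrowth

lemma coordMul_apply (a : ι) (f : 𝓢(EuclideanSpace ℝ ι, ℂ)) (x : EuclideanSpace ℝ ι) :
    coordMul a f x = (x a : ℂ) * f x :=
  SchwartzMap.smulLeftCLM_apply_apply (coord_hasTemperateGrowth a) f x

lemma coordMul_mul_comm (a b : ι) : coordMul a * coordMul b = coordMul b * coordMul a := by
  refine LinearMap.ext fun f => SchwartzMap.ext fun x => ?_
  simp only [Module.End.mul_apply, coordMul_apply]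
  ring

variable [DecidableEq ι]

/-- The partial derivative with respect to the coordinate with the index `a`. -/
def partialDeriv (a : ι) : Module.End ℂ 𝓢(EuclideanSpace ℝ ι, ℂ) :=
  (LineDeriv.lineDerivOpCLM ℂ 𝓢(EuclideanSpace ℝ ι, ℂ)
    (EuclideanSpace.single a (1 : ℝ))).toLinearMap

lemma partialDeriv_apply (a : ι) (f : 𝓢(EuclideanSpace ℝ ι, ℂ)) :
    partialDeriv a f = ∂_{EuclideanSpace.single a (1 : ℝ)} f := rfl

lemma partialDeriv_density (a : ι) (φ ψ : 𝓢(EuclideanSpace ℝ ι, ℂ)) :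
    partialDeriv a (density φ ψ)
      = density φ (partialDeriv a ψ) + density (partialDeriv a φ) ψ :=
  lineDerivOp_density _ φ ψ

lemma partialDeriv_mul_comm (a b : ι) :
    partialDeriv a * partialDeriv b = partialDeriv b * partialDeriv a :=
  LinearMap.ext fun f => lineDerivOp_lineDerivOp_comm _ _ f

lemma partialDeriv_mul_coordMul (a b : ι) :
    partialDeriv a * coordMul b = coordMul b * partialDeriv a + if a = b then 1 else 0 := by
  refine LinearMap.ext fun f => SchwartzMap.ext fun x => ?_
  have h : ((coordMul b f : 𝓢(EuclideanSpace ℝ ι, ℂ)) : EuclideanSpace ℝ ι → ℂ) =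
      fun y => (Complex.ofRealCLM ∘L (EuclideanSpace.proj b : EuclideanSpace ℝ ι →L[ℝ] ℝ)) y * f y := by
    ext y
    rw [coordMul_apply]
    rfl
  simp only [LinearMap.add_apply, Module.End.mul_apply, partialDeriv_apply,
    add_apply, coordMul_apply, SchwartzMap.lineDerivOp_apply_eq_fderiv]
  rw [h, fderiv_fun_mul (ContinuousLinearMap.differentiableAt _) f.differentiableAt,
    ContinuousLinearMap.fderiv]
  by_cases hab : a = b
  · subst hab
    simp
  · have hba : b ≠ a := fun h => hab h.symm
    simp [hab, hba]

lemma partialDeriv_mul_coordMul_self (a : ι) :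
    partialDeriv a * coordMul a = coordMul a * partialDeriv a + 1 := by
  rw [partialDeriv_mul_coordMul, if_pos rfl]

lemma partialDeriv_mul_coordMul_of_ne {a b : ι} (h : a ≠ b) :
    partialDeriv a * coordMul b = coordMul b * partialDeriv a := by
  rw [partialDeriv_mul_coordMul, if_neg h, add_zero]

/-! ### Ladder operators -/

/-- The normalization `(2B)^{-1/2}` of the ladder operators. -/
def ladderScale (B : ℝ) : ℂ := (((√(2 * B))⁻¹ : ℝ) : ℂ)

lemma ladderScale_mul_self {B : ℝ} (hB : 0 < B) : ladderScale B * ladderScale B = 1 / (2 * B) := by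
  rw [ladderScale, ← Complex.ofReal_mul, ← mul_inv, Real.mul_self_sqrt (by positivity)]
  push_cast
  simp

lemma conj_ladderScale (B : ℝ) : (starRingEnd ℂ) (ladderScale B) = ladderScale B :=
  Complex.conj_ofReal _

/-- The lowering operator `(π_x + i π_y) / √(2B)` of the Landau levels. -/
def lowering (B : ℝ) (a b : ι) : Module.End ℂ 𝓢(EuclideanSpace ℝ ι, ℂ) :=
  ladderScale B • ((-Complex.I) • partialDeriv a + partialDeriv b
    + (B / 2 : ℂ) • coordMul b - (Complex.I * B / 2) • coordMul a)

/-- The raising operator `(π_x - i π_y) / √(2B)` of the Landau levels. -/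
def raising (B : ℝ) (a b : ι) : Module.End ℂ 𝓢(EuclideanSpace ℝ ι, ℂ) :=
  ladderScale B • ((-Complex.I) • partialDeriv a - partialDeriv b
    + (B / 2 : ℂ) • coordMul b + (Complex.I * B / 2) • coordMul a)

/-- The derivative `-i (∂_x + i ∂_y) / √(2B)`. -/
def derivBar (B : ℝ) (a b : ι) : Module.End ℂ 𝓢(EuclideanSpace ℝ ι, ℂ) :=
  ladderScale B • ((-Complex.I) • partialDeriv a + partialDeriv b)

/-- The derivative `-i (∂_x - i ∂_y) / √(2B)`. -/
def derivHol (B : ℝ) (a b : ι) : Module.End ℂ 𝓢(EuclideanSpace ℝ ι, ℂ) :=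
  ladderScale B • ((-Complex.I) • partialDeriv a - partialDeriv b)

/-- The operator `-(∂_x² + ∂_y²) / (2B)`. -/
def scaledLaplacian (B : ℝ) (a b : ι) : Module.End ℂ 𝓢(EuclideanSpace ℝ ι, ℂ) :=
  ((-(1 / (2 * B)) : ℝ) : ℂ) • (partialDeriv a * partialDeriv a + partialDeriv b * partialDeriv b)

lemma derivHol_mul_derivBar {B : ℝ} (hB : 0 < B) (a b : ι) :
    derivHol B a b * derivBar B a b = scaledLaplacian B a b := by
  rw [derivHol, derivBar, smul_mul_smul_comm, ladderScale_mul_self hB, scaledLaplacian]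
  simp only [sub_mul, mul_add, smul_mul_assoc, mul_smul_comm, partialDeriv_mul_comm b a]
  push_cast
  match_scalars <;> ring_nf <;> simp <;> ring_nf

/-- Conjugating `a†` reverses the sign of its derivative part and gives it the same coordinate part
as `a`. In the difference the vector potential cancels and the product rule remains. -/
lemma derivBar_density (B : ℝ) (a b : ι) (φ ψ : 𝓢(EuclideanSpace ℝ ι, ℂ)) :
    derivBar B a b (density φ ψ)
      = density φ (lowering B a b ψ) - density (raising B a b φ) ψ := by
  ext x
  simp only [derivBar, lowering, raising, LinearMap.smul_apply, LinearMap.add_apply,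
    LinearMap.sub_apply, partialDeriv_density, density_apply, add_apply, sub_apply, smul_apply, smul_eq_mul,
    coordMul_apply, map_add, map_mul, map_sub, conj_ladderScale, Complex.conj_I, Complex.conj_ofReal,
    map_neg, map_div₀, map_ofNat]
  ring

lemma derivHol_density (B : ℝ) (a b : ι) (φ ψ : 𝓢(EuclideanSpace ℝ ι, ℂ)) :
    derivHol B a b (density φ ψ)
      = density φ (raising B a b ψ) - density (lowering B a b φ) ψ := by
  ext x
  simp only [derivHol, lowering, raising, LinearMap.smul_apply, LinearMap.add_apply,
    LinearMap.sub_apply, partialDeriv_density, density_apply, add_apply, sub_apply, smul_apply, smul_eq_mul,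
    coordMul_apply, map_add, map_mul, map_sub, conj_ladderScale, Complex.conj_I, Complex.conj_ofReal,
    map_neg, map_div₀, map_ofNat]
  ring

/-- The canonical commutation relation, a consequence of `[π_x, π_y] = iB`. -/
lemma lowering_mul_raising {B : ℝ} (hB : 0 < B) {a b : ι} (hab : a ≠ b) :
    lowering B a b * raising B a b = raising B a b * lowering B a b + 1 := by
  have hB' : (B : ℂ) ≠ 0 := by exact_mod_cast hB.ne'
  simp only [lowering, raising, smul_mul_smul_comm, ladderScale_mul_self hB]
  -- Both sides are brought to normal order, with derivatives to the right of coordinates, so that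
  -- only scalar coefficients of equal monomials have to be compared. The commutators below are
  -- computed in the same way.
  simp only [sub_mul, mul_sub, add_mul, mul_add, smul_mul_assoc, mul_smul_comm,
    partialDeriv_mul_comm b a, coordMul_mul_comm b a, partialDeriv_mul_coordMul_self,
    partialDeriv_mul_coordMul_of_ne hab, partialDeriv_mul_coordMul_of_ne hab.symm]
  match_scalars <;> field_simp <;> ring_nf <;> simp <;> norm_num

end Coordinates

/-! ### Guiding-centre operators, the number operator, adjoints, levels of Schwartz functions. -/

section Coordinates

variable {ι : Type*} [Fintype ι] [DecidableEq ι]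

/-- The component `-i ∂_x - (B/2) y` of the guiding-centre momentum. -/
def guidingX (B : ℝ) (a b : ι) : Module.End ℂ 𝓢(EuclideanSpace ℝ ι, ℂ) :=
  (-Complex.I) • partialDeriv a - (B / 2 : ℂ) • coordMul b

/-- The component `-i ∂_y + (B/2) x` of the guiding-centre momentum. -/
def guidingY (B : ℝ) (a b : ι) : Module.End ℂ 𝓢(EuclideanSpace ℝ ι, ℂ) :=
  (-Complex.I) • partialDeriv b + (B / 2 : ℂ) • coordMul a

/-- The guiding-centre momenta carry the vector potential with the opposite sign, so the two
contributions to each commutator with `π_x` and `π_y` cancel. They therefore preserve every Landau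
level. -/
lemma guidingX_commute_lowering (B : ℝ) {a b : ι} (hab : a ≠ b) :
    Commute (guidingX B a b) (lowering B a b) := by
  simp only [Commute, SemiconjBy, guidingX, lowering]
  simp only [sub_mul, mul_sub, add_mul, mul_add, smul_mul_assoc, mul_smul_comm,
    partialDeriv_mul_comm b a, coordMul_mul_comm b a, partialDeriv_mul_coordMul_self,
    partialDeriv_mul_coordMul_of_ne hab]
  match_scalars <;> ring_nf <;> simp <;> ring_nf

lemma guidingX_commute_raising (B : ℝ) {a b : ι} (hab : a ≠ b) :
    Commute (guidingX B a b) (raising B a b) := by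
  simp only [Commute, SemiconjBy, guidingX, raising]
  simp only [sub_mul, mul_sub, add_mul, mul_add, smul_mul_assoc, mul_smul_comm,
    partialDeriv_mul_comm b a, coordMul_mul_comm b a, partialDeriv_mul_coordMul_self,
    partialDeriv_mul_coordMul_of_ne hab]
  match_scalars <;> ring_nf <;> simp <;> ring_nf

lemma guidingY_commute_lowering (B : ℝ) {a b : ι} (hab : a ≠ b) :
    Commute (guidingY B a b) (lowering B a b) := by
  simp only [Commute, SemiconjBy, guidingY, lowering]
  simp only [sub_mul, mul_sub, add_mul, mul_add, smul_mul_assoc, mul_smul_comm,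
    partialDeriv_mul_comm b a, coordMul_mul_comm b a, partialDeriv_mul_coordMul_self,
    partialDeriv_mul_coordMul_of_ne hab.symm]
  match_scalars <;> ring_nf

lemma guidingY_commute_raising (B : ℝ) {a b : ι} (hab : a ≠ b) :
    Commute (guidingY B a b) (raising B a b) := by
  simp only [Commute, SemiconjBy, guidingY, raising]
  simp only [sub_mul, mul_sub, add_mul, mul_add, smul_mul_assoc, mul_smul_comm,
    partialDeriv_mul_comm b a, coordMul_mul_comm b a, partialDeriv_mul_coordMul_self,
    partialDeriv_mul_coordMul_of_ne hab.symm]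
  match_scalars <;> ring_nf

/-- The kinetic and the guiding-centre momentum differ by `B` times the coordinate, and `a + a†` is
proportional to `π_x`. This controls how multiplication by a coordinate moves between levels. -/
lemma coordMul_snd_eq {B : ℝ} (hB : 0 < B) (a b : ι) :
    coordMul b = (ladderScale B) • (lowering B a b + raising B a b)
      - (1 / B : ℂ) • guidingX B a b := by
  have hB' : (B : ℂ) ≠ 0 := by exact_mod_cast hB.ne'
  simp only [lowering, raising, ← smul_add, smul_smul, ladderScale_mul_self hB, guidingX]
  match_scalars <;> field_simp <;> ring

lemma coordMul_fst_eq {B : ℝ} (hB : 0 < B) (a b : ι) :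
    coordMul a = (1 / B : ℂ) • guidingY B a b
      + (Complex.I * ladderScale B) • (lowering B a b - raising B a b) := by
  have hB' : (B : ℂ) ≠ 0 := by exact_mod_cast hB.ne'
  simp only [lowering, raising, ← smul_sub, smul_smul, mul_assoc, ladderScale_mul_self hB, guidingY]
  match_scalars <;> field_simp <;> ring_nf <;> simp <;> norm_num

/-- `(π_x - iπ_y)(π_x + iπ_y) = π_x² + π_y² - B`; the last term is the commutator and accounts for
the zero-point energy. -/
lemma landauHamiltonian_eq {B m : ℝ} (hB : 0 < B) {a b : ι} (hab : a ≠ b)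
    (φ : 𝓢(EuclideanSpace ℝ ι, ℂ)) :
    landauHamiltonian B m a b φ = (B / m : ℂ) • raising B a b (lowering B a b φ)
      + (B / (2 * m) : ℂ) • φ := by
  have hB' : (B : ℂ) ≠ 0 := by exact_mod_cast hB.ne'
  have hx : (kineticX B a b).toLinearMap
      = (-Complex.I) • partialDeriv a + (B / 2 : ℂ) • coordMul b := by
    ext φ x
    simp [kineticX, partialDeriv, coordMul]
  have hy : (kineticY B a b).toLinearMap
      = (-Complex.I) • partialDeriv b - (B / 2 : ℂ) • coordMul a := by
    ext φ x
    simp [kineticY, partialDeriv, coordMul]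
  have h : (landauHamiltonian B m a b).toLinearMap
      = (B / m : ℂ) • (raising B a b * lowering B a b) + (B / (2 * m) : ℂ) • 1 := by
    have h1 : (landauHamiltonian B m a b).toLinearMap = (1 / (2 * m) : ℂ) •
        ((kineticX B a b).toLinearMap * (kineticX B a b).toLinearMap
          + (kineticY B a b).toLinearMap * (kineticY B a b).toLinearMap) := by
      ext φ x
      simp [landauHamiltonian]
    rw [h1, hx, hy]
    simp only [lowering, raising, smul_mul_smul_comm, ladderScale_mul_self hB]
    simp only [sub_mul, mul_sub, add_mul, mul_add, smul_mul_assoc, mul_smul_comm,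
      partialDeriv_mul_comm b a, coordMul_mul_comm b a, partialDeriv_mul_coordMul_self,
      partialDeriv_mul_coordMul_of_ne hab, partialDeriv_mul_coordMul_of_ne hab.symm]
    match_scalars <;> field_simp <;> ring_nf <;> simp
  exact congrArg (fun L : Module.End ℂ 𝓢(EuclideanSpace ℝ ι, ℂ) => L φ) h

lemma inner_toLp_eq_integral {E : Type*} [NormedAddCommGroup E] [InnerProductSpace ℝ E]
    [FiniteDimensional ℝ E] [MeasurableSpace E] [BorelSpace E] (φ ψ : 𝓢(E, ℂ)) :
    ⟪φ.toLp 2, ψ.toLp 2⟫_ℂ = SchwartzMap.integralCLM ℂ volume (density φ ψ) := by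
  rw [SchwartzMap.inner_toL2_toL2_eq φ ψ volume, SchwartzMap.integralCLM_apply]
  refine integral_congr_ae (Filter.Eventually.of_forall fun x => ?_)
  simp [density_apply]

lemma integral_lineDerivOp_density {E : Type*} [NormedAddCommGroup E] [InnerProductSpace ℝ E]
    [FiniteDimensional ℝ E] [MeasurableSpace E] [BorelSpace E] (v : E) (φ ψ : 𝓢(E, ℂ)) :
    SchwartzMap.integralCLM ℂ volume (∂_{v} (density φ ψ)) = 0 := by
  have h : ∂_{v} (density φ ψ) = density φ (∂_{v} ψ) + density (∂_{v} φ) ψ :=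
    lineDerivOp_density v φ ψ
  have hc : ∂_{v} (conjSchwartz φ) = conjSchwartz (∂_{v} φ) := by
    ext x
    rw [conjSchwartz_apply, SchwartzMap.lineDerivOp_apply_eq_fderiv,
      SchwartzMap.lineDerivOp_apply_eq_fderiv, fderiv_conjSchwartz]
  have h2 := SchwartzMap.integral_mul_lineDerivOp_right_eq_neg_left (μ := volume)
    (conjSchwartz φ) ψ v
  rw [h, map_add, SchwartzMap.integralCLM_apply, SchwartzMap.integralCLM_apply]
  simp only [density_apply]
  rw [hc] at h2
  simp only [conjSchwartz_apply] at h2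
  simp only [mul_comm (ψ _), mul_comm ((∂_{v} ψ) _)]
  rw [h2]
  ring

/-- By `derivBar_density` the difference of the two sides is the integral of a derivative of a
Schwartz function, which vanishes. -/
lemma inner_raising_left (B : ℝ) (a b : ι) (φ ψ : 𝓢(EuclideanSpace ℝ ι, ℂ)) :
    ⟪(raising B a b φ).toLp 2, ψ.toLp 2⟫_ℂ = ⟪φ.toLp 2, (lowering B a b ψ).toLp 2⟫_ℂ := by
  rw [inner_toLp_eq_integral, inner_toLp_eq_integral, eq_comm, ← sub_eq_zero, ← map_sub,
    ← derivBar_density]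
  simp only [derivBar, LinearMap.smul_apply, LinearMap.add_apply, map_smul, map_add,
    partialDeriv_apply, integral_lineDerivOp_density, smul_zero, add_zero]

lemma inner_lowering_left (B : ℝ) (a b : ι) (φ ψ : 𝓢(EuclideanSpace ℝ ι, ℂ)) :
    ⟪(lowering B a b φ).toLp 2, ψ.toLp 2⟫_ℂ = ⟪φ.toLp 2, (raising B a b ψ).toLp 2⟫_ℂ := by
  rw [← inner_conj_symm, ← inner_raising_left, inner_conj_symm]

/-! ### The Landau levels in the space of Schwartz functions -/

/-- The Schwartz functions in the `n`-th Landau level with respect to the coordinates with the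
indices `a`, `b`: the eigenspace of the number operator. -/
def schwartzLevel (B : ℝ) (a b : ι) (n : ℕ) : Submodule ℂ 𝓢(EuclideanSpace ℝ ι, ℂ) :=
  Module.End.eigenspace (raising B a b * lowering B a b) (n : ℂ)

lemma mem_schwartzLevel {B : ℝ} {a b : ι} {n : ℕ} {φ : 𝓢(EuclideanSpace ℝ ι, ℂ)} :
    φ ∈ schwartzLevel B a b n ↔ raising B a b (lowering B a b φ) = (n : ℂ) • φ :=
  Module.End.mem_eigenspace_iff

lemma lowering_raising {B : ℝ} (hB : 0 < B) {a b : ι} (hab : a ≠ b)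
    (φ : 𝓢(EuclideanSpace ℝ ι, ℂ)) :
    lowering B a b (raising B a b φ) = raising B a b (lowering B a b φ) + φ :=
  congrArg (fun L : Module.End ℂ 𝓢(EuclideanSpace ℝ ι, ℂ) => L φ) (lowering_mul_raising hB hab)

section Ladder

variable {B : ℝ} {a b : ι} {n k : ℕ} {φ ψ : 𝓢(EuclideanSpace ℝ ι, ℂ)}

lemma raising_mem (hB : 0 < B) (hab : a ≠ b) (h : φ ∈ schwartzLevel B a b n) :
    raising B a b φ ∈ schwartzLevel B a b (n + 1) := by
  rw [mem_schwartzLevel] at h ⊢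
  rw [lowering_raising hB hab, h, map_add, map_smul]
  push_cast
  rw [add_smul, one_smul]

lemma lowering_mem (hB : 0 < B) (hab : a ≠ b) (h : φ ∈ schwartzLevel B a b (n + 1)) :
    lowering B a b φ ∈ schwartzLevel B a b n := by
  rw [mem_schwartzLevel] at h ⊢
  have h2 := lowering_raising hB hab (lowering B a b φ)
  rw [h, map_smul] at h2
  rw [← sub_eq_iff_eq_add.mpr h2]
  push_cast
  rw [add_smul, one_smul, add_sub_cancel_right]

/-- `‖aφ‖² = ⟪a†aφ, φ⟫ = 0`. -/
lemma lowering_eq_zero (h : φ ∈ schwartzLevel B a b 0) : lowering B a b φ = 0 := by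
  rw [mem_schwartzLevel] at h
  have h2 := inner_raising_left B a b (lowering B a b φ) φ
  rw [h, Nat.cast_zero, zero_smul] at h2
  have h3 : (lowering B a b φ).toLp 2 = (0 : Lp ℂ 2 (volume : Measure (EuclideanSpace ℝ ι))) := by
    rw [← inner_self_eq_zero (𝕜 := ℂ), ← h2, inner_toLp_eq_integral, SchwartzMap.integralCLM_apply]
    simp [density_apply]
  have h4 := map_zero (SchwartzMap.toLpCLM ℂ ℂ 2 (volume : Measure (EuclideanSpace ℝ ι)))
  exact SchwartzMap.injective_toLp 2 volume (h3.trans h4.symm)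

lemma raising_pow_mem (hB : 0 < B) (hab : a ≠ b) (h : φ ∈ schwartzLevel B a b 0) (n : ℕ) :
    (raising B a b ^ n) φ ∈ schwartzLevel B a b n := by
  induction n with
  | zero => exact h
  | succ n ih =>
    rw [pow_succ', Module.End.mul_apply]
    exact raising_mem hB hab ih

lemma lowering_pow_mem (hB : 0 < B) (hab : a ≠ b) (h : φ ∈ schwartzLevel B a b n) :
    (lowering B a b ^ n) φ ∈ schwartzLevel B a b 0 := by
  induction n generalizing φ with
  | zero => exact h
  | succ n ih =>
    rw [pow_succ, Module.End.mul_apply]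
    exact ih (lowering_mem hB hab h)

lemma raising_pow_lowering_pow (hB : 0 < B) (hab : a ≠ b) (h : φ ∈ schwartzLevel B a b n) :
    (raising B a b ^ n) ((lowering B a b ^ n) φ) = (n.factorial : ℂ) • φ := by
  induction n generalizing φ with
  | zero => simp
  | succ n ih =>
    rw [pow_succ (lowering B a b), pow_succ', Module.End.mul_apply, Module.End.mul_apply,
      ih (lowering_mem hB hab h), map_smul, mem_schwartzLevel.mp h, smul_smul, Nat.factorial_succ]
    push_cast
    rw [mul_comm]

lemma lowering_raising_pow (hB : 0 < B) (hab : a ≠ b) (h : φ ∈ schwartzLevel B a b 0) (n : ℕ) :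
    lowering B a b ((raising B a b ^ (n + 1)) φ) = ((n + 1 : ℕ) : ℂ) • (raising B a b ^ n) φ := by
  rw [pow_succ', Module.End.mul_apply, lowering_raising hB hab,
    mem_schwartzLevel.mp (raising_pow_mem hB hab h n)]
  push_cast
  rw [add_smul, one_smul]

lemma lowering_pow_raising_pow (hB : 0 < B) (hab : a ≠ b) (h : φ ∈ schwartzLevel B a b 0)
    (n : ℕ) : (lowering B a b ^ n) ((raising B a b ^ n) φ) = (n.factorial : ℂ) • φ := by
  induction n with
  | zero => simp
  | succ n ih =>
    rw [pow_succ (lowering B a b), Module.End.mul_apply, lowering_raising_pow hB hab h, map_smul,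
      ih, smul_smul, Nat.factorial_succ]
    push_cast
    rfl

end Ladder

/-! ### Laguerre polynomials -/

lemma laguerre_coeff (n l : ℕ) :
    (laguerre n).coeff l = (n.choose l : ℂ) * (-1) ^ l / (l.factorial : ℂ) := by
  rw [laguerre, Polynomial.finsetSum_coeff]
  simp only [Polynomial.coeff_C_mul_X_pow]
  rw [Finset.sum_ite_eq]
  split_ifs with h
  · rfl
  · rw [Nat.choose_eq_zero_of_lt (by simpa using h)]
    simp

lemma laguerre_coeff_zero (n : ℕ) : (laguerre n).coeff 0 = 1 := by
  simp [laguerre_coeff]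

lemma laguerre_zero : laguerre 0 = 1 := by
  simp [laguerre]

lemma laguerre_one : laguerre 1 = 1 - Polynomial.X := by
  simp [laguerre, Finset.sum_range_succ, sub_eq_add_neg]

/-- The classical three-term recursion, verified on coefficients by Pascal's rule. It is the
recursion that the densities satisfy after division by factorials. -/
lemma laguerre_rec (k : ℕ) :
    ((k + 2 : ℕ) : ℂ) • laguerre (k + 2)
      = ((2 * k + 3 : ℕ) : ℂ) • laguerre (k + 1) - Polynomial.X * laguerre (k + 1)
        - ((k + 1 : ℕ) : ℂ) • laguerre k := by
  ext l
  cases l with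
  | zero =>
    simp only [Polynomial.coeff_smul, Polynomial.coeff_sub, laguerre_coeff_zero,
      Polynomial.mul_coeff_zero, Polynomial.coeff_X_zero, smul_eq_mul]
    push_cast
    ring
  | succ l =>
    simp only [Polynomial.coeff_smul, Polynomial.coeff_sub, laguerre_coeff,
      Polynomial.coeff_X_mul, smul_eq_mul]
    have h1 : (((k + 1).choose (l + 1) : ℕ) : ℂ) = k.choose l + k.choose (l + 1) := by
      rw [Nat.choose_succ_succ]
      push_cast
      rfl
    have h2 : (((k + 2).choose (l + 1) : ℕ) : ℂ) = (k + 1).choose l + (k + 1).choose (l + 1) := by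
      rw [Nat.choose_succ_succ]
      push_cast
      rfl
    -- The subtraction takes place in `ℂ`; for `l > k + 1` both binomial coefficients vanish.
    have h3 : ((k : ℂ) + 1 - l) * (k + 1).choose l = (k + 1) * k.choose l := by
      rcases le_or_gt l (k + 1) with h | h
      · have := Nat.choose_mul_succ_eq k l
        have h4 : ((k.choose l * (k + 1) : ℕ) : ℂ) = ((k + 1).choose l * (k + 1 - l) : ℕ) := by
          rw [this]
        push_cast [Nat.cast_sub h] at h4
        linear_combination -h4
      · rw [Nat.choose_eq_zero_of_lt h, Nat.choose_eq_zero_of_lt (by omega : k < l)]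
        simp
    have hl : ((l.factorial : ℕ) : ℂ) ≠ 0 := by exact_mod_cast l.factorial_ne_zero
    have hl1 : (l : ℂ) + 1 ≠ 0 := by exact_mod_cast l.succ_ne_zero
    rw [Nat.factorial_succ, h2]
    push_cast
    field_simp
    rw [pow_succ]
    linear_combination (-1) ^ (l + 1) * h3 + (-1) ^ l * (k + 1) * h1

end Coordinates

section Coordinates

variable {ι : Type*} [Fintype ι] [DecidableEq ι]

/-! ### The density of two states in a Landau level -/

section Density

variable {B : ℝ} {a b : ι} {f g φ ψ : 𝓢(EuclideanSpace ℝ ι, ℂ)} {n : ℕ}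

lemma scaledLaplacian_density (hB : 0 < B) (φ ψ : 𝓢(EuclideanSpace ℝ ι, ℂ)) :
    scaledLaplacian B a b (density φ ψ)
      = derivHol B a b (density φ (lowering B a b ψ))
        - derivHol B a b (density (raising B a b φ) ψ) := by
  rw [← derivHol_mul_derivBar hB, Module.End.mul_apply, derivBar_density, map_sub]

/-- Write `f_k = (a†)^k f` and `ρ_k` for the density of `f_k`, `g_k`. Since `a g_{k+1} = (k+1) g_k`,
the two terms of `scaledLaplacian_density` are `(k+1)(ρ_{k+1} - (k+1)ρ_k)` and `ρ_{k+2} -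
(k+2)ρ_{k+1}`; their difference is solved for `ρ_{k+2}`. -/
lemma density_raising_pow_succ_succ (hB : 0 < B) (hab : a ≠ b) (hf : f ∈ schwartzLevel B a b 0)
    (hg : g ∈ schwartzLevel B a b 0) (k : ℕ) :
    density ((raising B a b ^ (k + 2)) f) ((raising B a b ^ (k + 2)) g)
      = ((2 * k + 3 : ℕ) : ℂ) • density ((raising B a b ^ (k + 1)) f) ((raising B a b ^ (k + 1)) g)
        - scaledLaplacian B a b
          (density ((raising B a b ^ (k + 1)) f) ((raising B a b ^ (k + 1)) g))
        - ((k + 1 : ℕ) : ℂ) • ((k + 1 : ℕ) : ℂ) •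
          density ((raising B a b ^ k) f) ((raising B a b ^ k) g) := by
  have hr (k : ℕ) (f : 𝓢(EuclideanSpace ℝ ι, ℂ)) :
      raising B a b ((raising B a b ^ k) f) = (raising B a b ^ (k + 1)) f := by
    rw [pow_succ', Module.End.mul_apply]
  rw [scaledLaplacian_density hB, lowering_raising_pow hB hab hg, density_smul_right, map_smul,
    derivHol_density, derivHol_density, hr, hr, hr, lowering_raising_pow hB hab hf,
    lowering_raising_pow hB hab hf, density_smul_left, density_smul_left]
  simp only [Complex.conj_natCast]
  push_cast
  module

/-- After division by `n!` both sides obey `laguerre_rec` with `-Δ/(2B)` as the variable. In the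
case `n = 1` the missing terms vanish because `a` kills the lowest level. -/
lemma density_raising_pow (hB : 0 < B) (hab : a ≠ b) (hf : f ∈ schwartzLevel B a b 0)
    (hg : g ∈ schwartzLevel B a b 0) (n : ℕ) :
    density ((raising B a b ^ n) f) ((raising B a b ^ n) g)
      = (n.factorial : ℂ) •
        Polynomial.aeval (scaledLaplacian B a b) (laguerre n) (density f g) := by
  induction n using Nat.twoStepInduction with
  | zero => simp [laguerre_zero]
  | one =>
    rw [laguerre_one, map_sub, map_one, Polynomial.aeval_X, LinearMap.sub_apply,
      scaledLaplacian_density hB, lowering_eq_zero hg, density_zero_right, map_zero,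
      derivHol_density, lowering_raising hB hab, lowering_eq_zero hf, map_zero, zero_add]
    simp
  | more k ih0 ih1 =>
    have h := congrArg (fun p => Polynomial.aeval (scaledLaplacian B a b) p (density f g))
      (laguerre_rec k)
    simp only [map_sub, map_smul, map_mul, Polynomial.aeval_X, LinearMap.sub_apply,
      LinearMap.smul_apply, Module.End.mul_apply] at h
    rw [density_raising_pow_succ_succ hB hab hf hg, ih0, ih1, map_smul, Nat.factorial_succ (k + 1),
      mul_comm (k + 1 + 1), Nat.cast_mul, mul_smul, show k + 1 + 1 = k + 2 from rfl, h, Nat.factorial_succ k]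
    push_cast
    module

/-- The unitary map `(n!)^{-1/2} a^n` from the `n`-th to the lowest Landau level. -/
def levelDown (B : ℝ) (a b : ι) (n : ℕ) : Module.End ℂ 𝓢(EuclideanSpace ℝ ι, ℂ) :=
  (((√(n.factorial : ℝ))⁻¹ : ℝ) : ℂ) • lowering B a b ^ n

/-- The unitary map `(n!)^{-1/2} (a†)^n` from the lowest to the `n`-th Landau level. -/
def levelUp (B : ℝ) (a b : ι) (n : ℕ) : Module.End ℂ 𝓢(EuclideanSpace ℝ ι, ℂ) :=
  (((√(n.factorial : ℝ))⁻¹ : ℝ) : ℂ) • raising B a b ^ n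

lemma inv_sqrt_factorial_mul_self (n : ℕ) :
    (((√(n.factorial : ℝ))⁻¹ : ℝ) : ℂ) * (((√(n.factorial : ℝ))⁻¹ : ℝ) : ℂ)
      = (n.factorial : ℂ)⁻¹ := by
  rw [← Complex.ofReal_mul, ← mul_inv, Real.mul_self_sqrt (by positivity)]
  push_cast
  rfl

lemma levelDown_mem (hB : 0 < B) (hab : a ≠ b) (h : φ ∈ schwartzLevel B a b n) :
    levelDown B a b n φ ∈ schwartzLevel B a b 0 :=
  Submodule.smul_mem _ _ (lowering_pow_mem hB hab h)

lemma levelUp_mem (hB : 0 < B) (hab : a ≠ b) (h : φ ∈ schwartzLevel B a b 0) :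
    levelUp B a b n φ ∈ schwartzLevel B a b n :=
  Submodule.smul_mem _ _ (raising_pow_mem hB hab h n)

lemma levelUp_levelDown (hB : 0 < B) (hab : a ≠ b) (h : φ ∈ schwartzLevel B a b n) :
    levelUp B a b n (levelDown B a b n φ) = φ := by
  have hn : (n.factorial : ℂ) ≠ 0 := by exact_mod_cast n.factorial_ne_zero
  rw [levelUp, levelDown, LinearMap.smul_apply, LinearMap.smul_apply, map_smul,
    raising_pow_lowering_pow hB hab h, smul_smul, inv_sqrt_factorial_mul_self, smul_smul,
    inv_mul_cancel₀ hn, one_smul]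

lemma levelDown_levelUp (hB : 0 < B) (hab : a ≠ b) (h : φ ∈ schwartzLevel B a b 0) :
    levelDown B a b n (levelUp B a b n φ) = φ := by
  have hn : (n.factorial : ℂ) ≠ 0 := by exact_mod_cast n.factorial_ne_zero
  rw [levelUp, levelDown, LinearMap.smul_apply, LinearMap.smul_apply, map_smul,
    lowering_pow_raising_pow hB hab h, smul_smul, inv_sqrt_factorial_mul_self, smul_smul,
    inv_mul_cancel₀ hn, one_smul]

lemma inner_levelUp_left (φ ψ : 𝓢(EuclideanSpace ℝ ι, ℂ)) :
    ⟪(levelUp B a b n φ).toLp 2, ψ.toLp 2⟫_ℂ = ⟪φ.toLp 2, (levelDown B a b n ψ).toLp 2⟫_ℂ := by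
  have h (φ ψ : 𝓢(EuclideanSpace ℝ ι, ℂ)) :
      ⟪((raising B a b ^ n) φ).toLp 2, ψ.toLp 2⟫_ℂ
        = ⟪φ.toLp 2, ((lowering B a b ^ n) ψ).toLp 2⟫_ℂ := by
    induction n generalizing φ ψ with
    | zero => rfl
    | succ n ih =>
      rw [pow_succ', pow_succ, Module.End.mul_apply, inner_raising_left, ih, Module.End.mul_apply]
  have h2 := h φ ψ
  rw [inner_toLp_eq_integral, inner_toLp_eq_integral] at h2 ⊢
  rw [levelUp, levelDown, LinearMap.smul_apply, LinearMap.smul_apply, density_smul_left,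
    density_smul_right, map_smul, map_smul, h2, Complex.conj_ofReal]

/-- The one-particle form of the theorem: the two factors `(n!)^{-1/2}` cancel the `n!` of
`density_raising_pow`. -/
lemma density_eq_laguerre (hB : 0 < B) (hab : a ≠ b) (hφ : φ ∈ schwartzLevel B a b n)
    (hψ : ψ ∈ schwartzLevel B a b n) :
    density φ ψ = Polynomial.aeval (scaledLaplacian B a b) (laguerre n)
      (density (levelDown B a b n φ) (levelDown B a b n ψ)) := by
  have hn : (n.factorial : ℂ) ≠ 0 := by exact_mod_cast n.factorial_ne_zero
  nth_rw 1 [← levelUp_levelDown hB hab hφ, ← levelUp_levelDown hB hab hψ]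
  rw [levelUp, LinearMap.smul_apply, LinearMap.smul_apply, density_smul_left, density_smul_right,
    density_raising_pow hB hab (levelDown_mem hB hab hφ) (levelDown_mem hB hab hψ), smul_smul,
    Complex.conj_ofReal, inv_sqrt_factorial_mul_self, smul_smul, inv_mul_cancel₀ hn, one_smul]

end Density

/-! ### Ladder operators of different particles -/

section Commute

variable {B : ℝ} {a b c d : ι} {X : Module.End ℂ 𝓢(EuclideanSpace ℝ ι, ℂ)}

lemma commute_lowering (ha : Commute X (partialDeriv a)) (hb : Commute X (partialDeriv b))
    (ha' : Commute X (coordMul a)) (hb' : Commute X (coordMul b)) :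
    Commute X (lowering B a b) :=
  ((((ha.smul_right _).add_right hb).add_right (hb'.smul_right _)).sub_right
    (ha'.smul_right _)).smul_right _

lemma commute_raising (ha : Commute X (partialDeriv a)) (hb : Commute X (partialDeriv b))
    (ha' : Commute X (coordMul a)) (hb' : Commute X (coordMul b)) :
    Commute X (raising B a b) :=
  ((((ha.smul_right _).sub_right hb).add_right (hb'.smul_right _)).add_right
    (ha'.smul_right _)).smul_right _

lemma partialDeriv_commute (a b : ι) : Commute (partialDeriv a) (partialDeriv b) :=
  partialDeriv_mul_comm a b

omit [DecidableEq ι] in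
lemma coordMul_commute (a b : ι) : Commute (coordMul a) (coordMul b) :=
  coordMul_mul_comm a b

lemma partialDeriv_commute_coordMul {a b : ι} (h : a ≠ b) :
    Commute (partialDeriv a) (coordMul b) :=
  partialDeriv_mul_coordMul_of_ne h

lemma partialDeriv_commute_lowering (hac : c ≠ a) (hbc : c ≠ b) :
    Commute (partialDeriv c) (lowering B a b) :=
  commute_lowering (partialDeriv_commute _ _) (partialDeriv_commute _ _)
    (partialDeriv_commute_coordMul hac) (partialDeriv_commute_coordMul hbc)

lemma partialDeriv_commute_raising (hac : c ≠ a) (hbc : c ≠ b) :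
    Commute (partialDeriv c) (raising B a b) :=
  commute_raising (partialDeriv_commute _ _) (partialDeriv_commute _ _)
    (partialDeriv_commute_coordMul hac) (partialDeriv_commute_coordMul hbc)

lemma coordMul_commute_lowering (hac : a ≠ c) (hbc : b ≠ c) :
    Commute (coordMul c) (lowering B a b) :=
  commute_lowering (partialDeriv_commute_coordMul hac).symm
    (partialDeriv_commute_coordMul hbc).symm (coordMul_commute _ _) (coordMul_commute _ _)

lemma coordMul_commute_raising (hac : a ≠ c) (hbc : b ≠ c) :
    Commute (coordMul c) (raising B a b) :=
  commute_raising (partialDeriv_commute_coordMul hac).symm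
    (partialDeriv_commute_coordMul hbc).symm (coordMul_commute _ _) (coordMul_commute _ _)

end Commute

end Coordinates

/-! ### Ladder operators of many particles -/

section Particles

variable {N : ℕ} {B : ℝ} {n : ℕ} {i j : Fin N} {φ ψ : 𝓢(Config N, ℂ)}

lemma coord_ne (i : Fin N) : ((i, 0) : Fin N × Fin 2) ≠ (i, 1) := by
  simp

/-- The raising operator of the particle `i`. -/
abbrev particleRaising (B : ℝ) (i : Fin N) : Module.End ℂ 𝓢(Config N, ℂ) :=
  raising B (i, 0) (i, 1)

/-- The lowering operator of the particle `i`. -/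
abbrev particleLowering (B : ℝ) (i : Fin N) : Module.End ℂ 𝓢(Config N, ℂ) :=
  lowering B (i, 0) (i, 1)

lemma commute_of_partialDeriv_coordMul {X : Module.End ℂ 𝓢(Config N, ℂ)} (i : Fin N)
    (h : ∀ k : Fin 2, Commute (partialDeriv (i, k)) X ∧ Commute (coordMul (i, k)) X) :
    Commute (particleRaising B i) X ∧ Commute (particleLowering B i) X :=
  ⟨(commute_raising (h 0).1.symm (h 1).1.symm (h 0).2.symm (h 1).2.symm).symm,
    (commute_lowering (h 0).1.symm (h 1).1.symm (h 0).2.symm (h 1).2.symm).symm⟩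

lemma ladder_commute_lowering (hij : i ≠ j) :
    Commute (particleRaising B i) (particleLowering B j) ∧
      Commute (particleLowering B i) (particleLowering B j) :=
  commute_of_partialDeriv_coordMul i fun k =>
    ⟨partialDeriv_commute_lowering (by simp [hij]) (by simp [hij]),
      coordMul_commute_lowering (by simp [hij.symm]) (by simp [hij.symm])⟩

lemma ladder_commute_raising (hij : i ≠ j) :
    Commute (particleRaising B i) (particleRaising B j) ∧
      Commute (particleLowering B i) (particleRaising B j) :=
  commute_of_partialDeriv_coordMul i fun k =>
    ⟨partialDeriv_commute_raising (by simp [hij]) (by simp [hij]),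
      coordMul_commute_raising (by simp [hij.symm]) (by simp [hij.symm])⟩

/-- `levelDown` for the particle `i`. -/
def particleDown (B : ℝ) (n : ℕ) (i : Fin N) : Module.End ℂ 𝓢(Config N, ℂ) :=
  levelDown B (i, 0) (i, 1) n

/-- `levelUp` for the particle `i`. -/
def particleUp (B : ℝ) (n : ℕ) (i : Fin N) : Module.End ℂ 𝓢(Config N, ℂ) :=
  levelUp B (i, 0) (i, 1) n

/-- The Schwartz functions for which the particle `i` is in the `n`-th Landau level. -/
def particleLevel (B : ℝ) (n : ℕ) (i : Fin N) : Submodule ℂ 𝓢(Config N, ℂ) :=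
  schwartzLevel B (i, 0) (i, 1) n

/-- The operator `-Δ_i / (2B)`. -/
def particleLaplacian (B : ℝ) (i : Fin N) : Module.End ℂ 𝓢(Config N, ℂ) :=
  scaledLaplacian B (i, 0) (i, 1)

lemma particleDown_commute (hij : i ≠ j) :
    Commute (particleDown B n i) (particleDown B n j) :=
  (((ladder_commute_lowering hij).2.pow_pow n n).smul_left _).smul_right _

lemma particleUp_commute (hij : i ≠ j) :
    Commute (particleUp B n i) (particleUp B n j) :=
  (((ladder_commute_raising hij).1.pow_pow n n).smul_left _).smul_right _

lemma particleDown_mem_of_ne (hij : i ≠ j) {k : ℕ} (h : φ ∈ particleLevel B k j) :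
    particleDown B n i φ ∈ particleLevel B k j := by
  have hc : Commute (particleRaising B j * particleLowering B j) (particleDown B n i) :=
    ((((ladder_commute_raising hij).2.mul_right (ladder_commute_lowering hij).2).pow_left
      n).smul_left _).symm
  exact Module.End.mem_eigenspace_iff.mpr (by
    rw [← Module.End.mul_apply, hc.eq, Module.End.mul_apply, Module.End.mem_eigenspace_iff.mp h,
      map_smul])

lemma particleUp_mem_of_ne (hij : i ≠ j) {k : ℕ} (h : φ ∈ particleLevel B k j) :
    particleUp B n i φ ∈ particleLevel B k j := by
  have hc : Commute (particleRaising B j * particleLowering B j) (particleUp B n i) :=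
    ((((ladder_commute_raising hij).1.mul_right (ladder_commute_lowering hij).1).pow_left
      n).smul_left _).symm
  exact Module.End.mem_eigenspace_iff.mpr (by
    rw [← Module.End.mul_apply, hc.eq, Module.End.mul_apply, Module.End.mem_eigenspace_iff.mp h,
      map_smul])

/-- The product of the operators `particleDown` of the particles in the list `l`. -/
def listDown (B : ℝ) (n : ℕ) (l : List (Fin N)) : Module.End ℂ 𝓢(Config N, ℂ) :=
  (l.map (particleDown B n)).prod

/-- The product of the operators `particleUp` of the particles in the list `l`. -/
def listUp (B : ℝ) (n : ℕ) (l : List (Fin N)) : Module.End ℂ 𝓢(Config N, ℂ) :=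
  (l.map (particleUp B n)).prod

lemma listDown_cons (i : Fin N) (l : List (Fin N)) :
    listDown B n (i :: l) = particleDown B n i * listDown B n l :=
  List.prod_cons

lemma listUp_cons (i : Fin N) (l : List (Fin N)) :
    listUp B n (i :: l) = particleUp B n i * listUp B n l :=
  List.prod_cons

lemma commute_listDown {l : List (Fin N)} (h : i ∉ l) :
    Commute (particleDown B n i) (listDown B n l) :=
  Commute.list_prod_right _ _ fun x hx => by
    obtain ⟨j, hj, rfl⟩ := List.mem_map.mp hx
    exact particleDown_commute fun hij => h (hij ▸ hj)

lemma commute_listUp {l : List (Fin N)} (h : i ∉ l) :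
    Commute (particleUp B n i) (listUp B n l) :=
  Commute.list_prod_right _ _ fun x hx => by
    obtain ⟨j, hj, rfl⟩ := List.mem_map.mp hx
    exact particleUp_commute fun hij => h (hij ▸ hj)

lemma listDown_perm {l l' : List (Fin N)} (h : l.Perm l') (hl : l.Nodup) :
    listDown B n l = listDown B n l' :=
  (h.map _).prod_eq' (List.pairwise_map.mpr (hl.imp fun hij => particleDown_commute hij))

/-- The particles are lowered one at a time; lowering one leaves the number operators of the others
unchanged. Lists keep track of the order of factors in the noncommutative ring of operators. -/
lemma density_eq_list_prod (hB : 0 < B) {l : List (Fin N)} (hl : l.Nodup)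
    (hφ : ∀ i ∈ l, φ ∈ particleLevel B n i) (hψ : ∀ i ∈ l, ψ ∈ particleLevel B n i) :
    density φ ψ = (l.map fun i => Polynomial.aeval (particleLaplacian B i) (laguerre n)).prod
      (density (listDown B n l φ) (listDown B n l ψ)) := by
  induction l generalizing φ ψ with
  | nil => rfl
  | cons i l ih =>
    obtain ⟨hi, hl⟩ := List.nodup_cons.mp hl
    have hne {j : Fin N} (hj : j ∈ l) : i ≠ j := fun hij => hi (hij ▸ hj)
    rw [List.map_cons, List.prod_cons, listDown_cons, (commute_listDown hi).eq,
      Module.End.mul_apply, Module.End.mul_apply, Module.End.mul_apply,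
      ← ih hl (fun j hj => particleDown_mem_of_ne (hne hj) (hφ j (List.mem_cons_of_mem _ hj)))
        (fun j hj => particleDown_mem_of_ne (hne hj) (hψ j (List.mem_cons_of_mem _ hj)))]
    exact density_eq_laguerre hB (coord_ne i) (hφ i List.mem_cons_self) (hψ i List.mem_cons_self)

lemma inner_listUp_left {l : List (Fin N)} (hl : l.Nodup) (φ ψ : 𝓢(Config N, ℂ)) :
    ⟪(listUp B n l φ).toLp 2, ψ.toLp 2⟫_ℂ = ⟪φ.toLp 2, (listDown B n l ψ).toLp 2⟫_ℂ := by
  induction l generalizing φ ψ with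
  | nil => rfl
  | cons i l ih =>
    obtain ⟨hi, hl⟩ := List.nodup_cons.mp hl
    rw [listDown_cons, (commute_listDown hi).eq, listUp_cons, Module.End.mul_apply,
      Module.End.mul_apply, ← ih hl]
    exact inner_levelUp_left _ _

lemma listUp_listDown (hB : 0 < B) {l : List (Fin N)} (hl : l.Nodup)
    (hφ : ∀ i ∈ l, φ ∈ particleLevel B n i) : listUp B n l (listDown B n l φ) = φ := by
  induction l generalizing φ with
  | nil => rfl
  | cons i l ih =>
    obtain ⟨hi, hl⟩ := List.nodup_cons.mp hl
    have hne {j : Fin N} (hj : j ∈ l) : i ≠ j := fun hij => hi (hij ▸ hj)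
    rw [listDown_cons, (commute_listDown hi).eq, listUp_cons, Module.End.mul_apply,
      Module.End.mul_apply,
      ih hl (fun j hj => particleDown_mem_of_ne (hne hj) (hφ j (List.mem_cons_of_mem _ hj)))]
    exact levelUp_levelDown hB (coord_ne i) (hφ i List.mem_cons_self)

lemma listDown_listUp (hB : 0 < B) {l : List (Fin N)} (hl : l.Nodup)
    (hφ : ∀ i ∈ l, φ ∈ particleLevel B 0 i) : listDown B n l (listUp B n l φ) = φ := by
  induction l generalizing φ with
  | nil => rfl
  | cons i l ih =>
    obtain ⟨hi, hl⟩ := List.nodup_cons.mp hl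
    have hne {j : Fin N} (hj : j ∈ l) : i ≠ j := fun hij => hi (hij ▸ hj)
    rw [listUp_cons, (commute_listUp hi).eq, listDown_cons, Module.End.mul_apply,
      Module.End.mul_apply,
      ih hl (fun j hj => particleUp_mem_of_ne (hne hj) (hφ j (List.mem_cons_of_mem _ hj)))]
    exact levelDown_levelUp hB (coord_ne i) (hφ i List.mem_cons_self)

/-! ### Push-forwards of densities -/

/-- After Fourier transformation push-forward is composition with `Aᵀ` and derivatives are
multiplications, so the claim becomes `⟪Aᵀξ, v⟫ = ⟪ξ, Av⟫`. -/
lemma lineDerivOp_pushforward {E F : Type*} [NormedAddCommGroup E] [InnerProductSpace ℝ E]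
    [FiniteDimensional ℝ E] [NormedAddCommGroup F] [InnerProductSpace ℝ F] [FiniteDimensional ℝ F]
    [MeasurableSpace E] [BorelSpace E] [MeasurableSpace F] [BorelSpace F]
    (A : E →L[ℝ] F) (hA : Function.Surjective A) (v : E) (f : 𝓢(E, ℂ)) :
    pushforward A hA (∂_{v} f) = ∂_{A v} (pushforward A hA f) := by
  have hinj : Function.Injective (𝓕 : 𝓢(F, ℂ) → 𝓢(F, ℂ)) := fun g h hgh => by
    simpa using congrArg (fun u : 𝓢(F, ℂ) => (𝓕⁻ u : 𝓢(F, ℂ))) hgh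
  have hF (f : 𝓢(E, ℂ)) (ξ : F) :
      𝓕 (pushforward A hA f) ξ = 𝓕 f (ContinuousLinearMap.adjoint A ξ) := by
    have h : 𝓕 (pushforward A hA f) = SchwartzMap.compCLMOfAntilipschitz ℂ
        (ContinuousLinearMap.adjoint A).hasTemperateGrowth
        (exists_antilipschitz_adjoint A hA).choose_spec (𝓕 f) :=
      FourierTransform.fourier_fourierInv_eq _
    rw [h]
    rfl
  apply hinj
  ext ξ
  rw [hF, SchwartzMap.fourier_lineDerivOp_eq, SchwartzMap.fourier_lineDerivOp_eq]
  rw [smul_apply, smul_apply, SchwartzMap.smulLeftCLM_apply_apply (by fun_prop),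
    SchwartzMap.smulLeftCLM_apply_apply (by fun_prop), hF, ContinuousLinearMap.adjoint_inner_left]

variable {F : Type*} [AddCommGroup F] [Module ℂ F]

lemma map_aeval_of_intertwine {V : Type*} [AddCommGroup V] [Module ℂ V] {P : V →ₗ[ℂ] F}
    {S : Module.End ℂ V} {T : Module.End ℂ F} (h : ∀ f, P (S f) = T (P f)) (p : Polynomial ℂ)
    (f : V) : P (Polynomial.aeval S p f) = Polynomial.aeval T p (P f) := by
  induction p using Polynomial.induction_on' generalizing f with
  | add p q hp hq => simp only [map_add, LinearMap.add_apply, hp, hq]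
  | monomial k c =>
    simp only [Polynomial.aeval_monomial, Module.End.mul_apply, Module.algebraMap_end_apply,
      map_smul]
    congr 1
    induction k generalizing f with
    | zero => rfl
    | succ k ih => rw [pow_succ, pow_succ, Module.End.mul_apply, Module.End.mul_apply, ih, h]

/-- If the linear map `P` intertwines `-Δ_i/(2B)` with `T i` for all particles `i`, it maps the
density of two states in the `n`-th Landau level to `∏_i L_n(T i)` applied to the image of the
density of the corresponding states in the lowest Landau level. -/
lemma map_density_eq (hB : 0 < B) (P : 𝓢(Config N, ℂ) →ₗ[ℂ] F) (T : Fin N → Module.End ℂ F)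
    (hT : ∀ i f, P (particleLaplacian B i f) = T i (P f)) {l : List (Fin N)}
    (hl : l.Perm (List.finRange N))
    (hφ : ∀ i, φ ∈ particleLevel B n i) (hψ : ∀ i, ψ ∈ particleLevel B n i) :
    P (density φ ψ) = (l.map fun i => Polynomial.aeval (T i) (laguerre n)).prod
      (P (density (listDown B n (List.finRange N) φ) (listDown B n (List.finRange N) ψ))) := by
  have hd : l.Nodup := hl.nodup_iff.mpr (List.nodup_finRange N)
  rw [density_eq_list_prod hB hd (fun i _ => hφ i) (fun i _ => hψ i), listDown_perm hl hd]
  generalize density (listDown B n (List.finRange N) φ) (listDown B n (List.finRange N) ψ) = f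
  clear hl hd
  induction l generalizing f with
  | nil => rfl
  | cons i l ih =>
    rw [List.map_cons, List.prod_cons, List.map_cons, List.prod_cons, Module.End.mul_apply,
      Module.End.mul_apply, map_aeval_of_intertwine (hT i), ih]

/-- `L_n(0) = 1`: a particle on which the potential does not depend contributes no factor. -/
lemma aeval_zero_laguerre (n : ℕ) :
    Polynomial.aeval (0 : Module.End ℂ F) (laguerre n) = 1 := by
  rw [← Polynomial.coeff_zero_eq_aeval_zero', laguerre_coeff_zero, map_one]

end Particles

/-! ### Transformation of the potentials -/

section Potentials

variable {N : ℕ} {B : ℝ} {n : ℕ} {φ ψ : 𝓢(Config N, ℂ)}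

/-- The list `l` is completed to an enumeration of all particles; the added ones have `T i = 0` and
contribute `L_n(0) = 1`. The order within `l` remains free. -/
lemma map_density_eq_of_support {F : Type*} [AddCommGroup F] [Module ℂ F] (hB : 0 < B)
    (P : 𝓢(Config N, ℂ) →ₗ[ℂ] F) (T : Fin N → Module.End ℂ F)
    (hT : ∀ i f, P (particleLaplacian B i f) = T i (P f)) {l : List (Fin N)}
    (hl : l.Nodup) (h0 : ∀ i, i ∉ l → T i = 0)
    (hφ : ∀ i, φ ∈ particleLevel B n i) (hψ : ∀ i, ψ ∈ particleLevel B n i) :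
    P (density φ ψ) = (l.map fun i => Polynomial.aeval (T i) (laguerre n)).prod
      (P (density (listDown B n (List.finRange N) φ) (listDown B n (List.finRange N) ψ))) := by
  have hf : ((List.finRange N).filter (· ∉ l)).Nodup := (List.nodup_finRange N).filter _
  have hperm : (l ++ (List.finRange N).filter (· ∉ l)).Perm (List.finRange N) := by
    refine (List.perm_ext_iff_of_nodup (hl.append hf ?_) (List.nodup_finRange N)).mpr fun i => ?_
    · intro i hi hi'
      simp [hi] at hi'
    · by_cases hi : i ∈ l <;> simp [hi]
  rw [map_density_eq hB P T hT hperm hφ hψ, List.map_append, List.prod_append,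
    List.prod_eq_one (l := ((List.finRange N).filter (· ∉ l)).map _), mul_one]
  intro x hx
  obtain ⟨j, hj, rfl⟩ := List.mem_map.mp hx
  rw [h0 j (by simpa using hj), aeval_zero_laguerre]

/-! ### One-particle Laplacians under push-forward. -/

section PushLaplacian

variable {F : Type*} [NormedAddCommGroup F] [InnerProductSpace ℝ F] [FiniteDimensional ℝ F]

/-- The operator on functions of `A r` that is induced by `-Δ_i/(2B)`. -/
def pushLaplacian (B : ℝ) (A : Config N →L[ℝ] F) (i : Fin N) : Module.End ℂ 𝓢(F, ℂ) :=
  ((-(1 / (2 * B)) : ℝ) : ℂ) • ∑ k : Fin 2,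
    ((LineDeriv.lineDerivOpCLM ℂ 𝓢(F, ℂ) (A (EuclideanSpace.single (i, k) 1))).toLinearMap *
      (LineDeriv.lineDerivOpCLM ℂ 𝓢(F, ℂ) (A (EuclideanSpace.single (i, k) 1))).toLinearMap :
      Module.End ℂ 𝓢(F, ℂ))

lemma pushLaplacian_apply (A : Config N →L[ℝ] F) (i : Fin N) (f : 𝓢(F, ℂ)) :
    pushLaplacian B A i f = ((-(1 / (2 * B)) : ℝ) : ℂ) • ∑ k : Fin 2,
      ∂_{A (EuclideanSpace.single (i, k) 1)} (∂_{A (EuclideanSpace.single (i, k) 1)} f) := by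
  simp [pushLaplacian]

lemma pushLaplacian_eq_zero {A : Config N →L[ℝ] F} {i : Fin N}
    (h : ∀ k, A (EuclideanSpace.single (i, k) 1) = 0) : pushLaplacian B A i = 0 := by
  ext1 f
  simp [pushLaplacian_apply, h, LineDeriv.lineDerivOp_left_zero]

variable [MeasurableSpace F] [BorelSpace F]

lemma pushforward_particleLaplacian (A : Config N →L[ℝ] F) (hA : Function.Surjective A)
    (i : Fin N) (f : 𝓢(Config N, ℂ)) :
    pushforward A hA (particleLaplacian B i f) = pushLaplacian B A i (pushforward A hA f) := by
  rw [pushLaplacian_apply]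
  simp only [particleLaplacian, scaledLaplacian, LinearMap.smul_apply, LinearMap.add_apply,
    Module.End.mul_apply, partialDeriv_apply, map_smul, map_add, lineDerivOp_pushforward,
    Fin.sum_univ_two]

lemma pushforward_density_eq (hB : 0 < B) (A : Config N →L[ℝ] F) (hA : Function.Surjective A)
    {l : List (Fin N)} (hl : l.Nodup)
    (h0 : ∀ i, i ∉ l → ∀ k, A (EuclideanSpace.single (i, k) 1) = 0)
    (hφ : ∀ i, φ ∈ particleLevel B n i) (hψ : ∀ i, ψ ∈ particleLevel B n i) :
    pushforward A hA (density φ ψ)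
      = (l.map fun i => Polynomial.aeval (pushLaplacian B A i) (laguerre n)).prod
      (pushforward A hA
        (density (listDown B n (List.finRange N) φ) (listDown B n (List.finRange N) ψ))) :=
  map_density_eq_of_support hB (pushforward A hA).toLinearMap _
    (pushforward_particleLaplacian A hA) hl (fun i hi => pushLaplacian_eq_zero (h0 i hi)) hφ hψ

end PushLaplacian

/-! ### Passing operators from distributions to test functions. -/

section Duality

variable {E : Type*} [NormedAddCommGroup E] [NormedSpace ℝ E]

lemma aeval_apply_of_dual {S : Module.End ℂ 𝓢'(E, ℂ)} {T : Module.End ℂ 𝓢(E, ℂ)}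
    (h : ∀ (V : 𝓢'(E, ℂ)) f, S V f = V (T f)) (p : Polynomial ℂ) (V : 𝓢'(E, ℂ)) (f : 𝓢(E, ℂ)) :
    Polynomial.aeval S p V f = V (Polynomial.aeval T p f) := by
  induction p using Polynomial.induction_on' generalizing f with
  | add p q hp hq => simp only [map_add, LinearMap.add_apply, ← hp, ← hq]; rfl
  | monomial k c =>
    simp only [Polynomial.aeval_monomial, Module.End.mul_apply, Module.algebraMap_end_apply,
      map_smul]
    change c • ((S ^ k) V) f = _
    congr 1
    induction k generalizing f with
    | zero => rfl
    | succ k ih => rw [pow_succ', pow_succ, Module.End.mul_apply, Module.End.mul_apply, h, ih]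

/-- Transposition reverses the order of a product, hence the reversed list. -/
lemma list_prod_apply_of_dual {κ : Type*} {S : κ → Module.End ℂ 𝓢'(E, ℂ)}
    {T : κ → Module.End ℂ 𝓢(E, ℂ)} (h : ∀ i (V : 𝓢'(E, ℂ)) f, S i V f = V (T i f)) (l : List κ)
    (V : 𝓢'(E, ℂ)) (f : 𝓢(E, ℂ)) :
    (l.map S).prod V f = V ((l.reverse.map T).prod f) := by
  induction l generalizing f with
  | nil => rfl
  | cons i l ih =>
    rw [List.map_cons, List.prod_cons, Module.End.mul_apply, h, ih, List.reverse_cons,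
      List.map_append, List.prod_append, List.map_singleton, List.prod_singleton,
      Module.End.mul_apply]

end Duality

lemma laguerreLaplacian_apply (V : 𝓢'(Plane, ℂ)) (f : 𝓢(Plane, ℂ)) :
    laguerreLaplacian B n V f
      = V (Polynomial.aeval (scaledLaplacian B 0 1) (laguerre n) f) := by
  refine aeval_apply_of_dual (fun V f => ?_) _ V f
  change ((-(1 / (2 * B)) : ℝ) : ℂ) • (LineDeriv.laplacianCLM ℂ Plane 𝓢'(Plane, ℂ) V) f = _
  rw [TemperedDistribution.laplacianCLM_apply, TemperedDistribution.laplacian_apply_apply,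
    SchwartzMap.laplacian_eq_sum (EuclideanSpace.basisFun (Fin 2) ℝ), ← map_smul]
  simp [scaledLaplacian, partialDeriv_apply, Fin.sum_univ_two]

lemma partialLaplacian_apply {ℓ : ℕ} (i : Fin ℓ) (W : 𝓢'(Config ℓ, ℂ)) (f : 𝓢(Config ℓ, ℂ)) :
    (((-(1 / (2 * B)) : ℝ) : ℂ) • partialLaplacian i) W f = W (particleLaplacian B i f) := by
  simp [partialLaplacian, Fin.sum_univ_two, particleLaplacian, scaledLaplacian, partialDeriv_apply]

lemma laguerreLaplacianProd_apply {ℓ : ℕ} (W : 𝓢'(Config ℓ, ℂ)) (f : 𝓢(Config ℓ, ℂ)) :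
    laguerreLaplacianProd B n ℓ W f
      = W (((List.finRange ℓ).reverse.map fun i =>
        Polynomial.aeval (particleLaplacian B i) (laguerre n)).prod f) := by
  rw [laguerreLaplacianProd, List.ofFn_eq_map]
  exact list_prod_apply_of_dual
    (fun i V f => aeval_apply_of_dual (partialLaplacian_apply i) (laguerre n) V f) _ W f

end Potentials

/-! ### The effective one-, two- and many-body potentials. -/

section Potentials

variable {N : ℕ} {B : ℝ} {n : ℕ} {φ ψ : 𝓢(Config N, ℂ)}

lemma position_single (i j : Fin N) (k : Fin 2) :
    position i (EuclideanSpace.single (j, k) (1 : ℝ))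
      = if j = i then EuclideanSpace.single k 1 else 0 := by
  ext k'
  rw [position_apply]
  by_cases h : j = i
  · subst h
    simp
  · simp [h, Ne.symm h]

lemma select_single {ℓ : ℕ} {s : Fin ℓ → Fin N} (hs : Function.Injective s) (j : Fin ℓ)
    (k : Fin 2) :
    select s (EuclideanSpace.single (s j, k) (1 : ℝ)) = EuclideanSpace.single (j, k) 1 := by
  ext ⟨j', k'⟩
  simp [hs.eq_iff]

lemma select_single_eq_zero {ℓ : ℕ} {s : Fin ℓ → Fin N} {i : Fin N} (h : ∀ j, s j ≠ i)
    (k : Fin 2) : select s (EuclideanSpace.single (i, k) (1 : ℝ)) = 0 := by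
  ext ⟨j', k'⟩
  simp [h]

lemma pushLaplacian_position (i : Fin N) :
    pushLaplacian B (position i) i = scaledLaplacian B 0 1 := by
  ext1 f
  simp [pushLaplacian_apply, position_single, Fin.sum_univ_two, scaledLaplacian,
    partialDeriv_apply]

lemma pushLaplacian_relPosition_left {i j : Fin N} (hij : i ≠ j) :
    pushLaplacian B (relPosition i j) i = scaledLaplacian B 0 1 := by
  ext1 f
  simp [pushLaplacian_apply, relPosition, position_single, hij, Fin.sum_univ_two, scaledLaplacian,
    partialDeriv_apply]

/-- The minus sign of `r_j` in `r_i - r_j` disappears in second derivatives. -/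
lemma pushLaplacian_relPosition_right {i j : Fin N} (hij : i ≠ j) :
    pushLaplacian B (relPosition i j) j = scaledLaplacian B 0 1 := by
  ext1 f
  simp [pushLaplacian_apply, relPosition, position_single, hij.symm, Fin.sum_univ_two,
    scaledLaplacian, partialDeriv_apply, LineDeriv.lineDerivOp_left_neg,
    LineDeriv.lineDerivOp_neg]

lemma pushLaplacian_select {ℓ : ℕ} {s : Fin ℓ → Fin N} (hs : Function.Injective s) (j : Fin ℓ) :
    pushLaplacian B (select s) (s j) = particleLaplacian B j := by
  ext1 f
  simp [pushLaplacian_apply, select_single hs, Fin.sum_univ_two, particleLaplacian,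
    scaledLaplacian, partialDeriv_apply]

lemma sum_tempered_apply {κ E : Type*} [NormedAddCommGroup E] [NormedSpace ℝ E] (s : Finset κ)
    (Q : κ → 𝓢'(E, ℂ)) (f : 𝓢(E, ℂ)) : (∑ i ∈ s, Q i) f = ∑ i ∈ s, Q i f := by
  classical
  induction s using Finset.induction_on with
  | empty => rfl
  | insert i s hi ih => rw [Finset.sum_insert hi, Finset.sum_insert hi, ← ih]; rfl

lemma oneBody_density (hB : 0 < B) (V : 𝓢'(Plane, ℂ))
    (hφ : ∀ i, φ ∈ particleLevel B n i) (hψ : ∀ i, ψ ∈ particleLevel B n i) :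
    oneBody N V (density φ ψ) = oneBody N (laguerreLaplacian B n V)
      (density (listDown B n (List.finRange N) φ) (listDown B n (List.finRange N) ψ)) := by
  rw [oneBody, oneBody, sum_tempered_apply, sum_tempered_apply]
  refine Finset.sum_congr rfl fun i _ => ?_
  change V (pushforward _ _ _) = laguerreLaplacian B n V (pushforward _ _ _)
  rw [laguerreLaplacian_apply, pushforward_density_eq hB (position i) (position_surjective i)
    (List.nodup_singleton i) ?_ hφ hψ]
  · simp [pushLaplacian_position]
  · intro j hj k
    rw [position_single, if_neg (by simpa using hj)]

/-- On functions of `r_i - r_j` the Laplacians of both particles become the same planar Laplacian,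
which is why `L_n` appears squared. -/
lemma twoBody_density (hB : 0 < B) (w : 𝓢'(Plane, ℂ))
    (hφ : ∀ i, φ ∈ particleLevel B n i) (hψ : ∀ i, ψ ∈ particleLevel B n i) :
    twoBody N w (density φ ψ) = twoBody N ((laguerreLaplacian B n ^ 2) w)
      (density (listDown B n (List.finRange N) φ) (listDown B n (List.finRange N) ψ)) := by
  rw [twoBody, twoBody, sum_tempered_apply, sum_tempered_apply]
  refine Finset.sum_congr rfl fun p _ => ?_
  obtain ⟨⟨i, j⟩, hij⟩ := p
  have hne : i ≠ j := ne_of_lt hij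
  change w (pushforward _ _ _) = (laguerreLaplacian B n ^ 2) w (pushforward _ _ _)
  rw [pow_two, Module.End.mul_apply, laguerreLaplacian_apply, laguerreLaplacian_apply,
    pushforward_density_eq hB (relPosition i j) (relPosition_surjective hne) (l := [i, j])
    (by simpa using hne) ?_ hφ hψ]
  · simp [pushLaplacian_relPosition_left hne, pushLaplacian_relPosition_right hne]
  · intro k hk c
    have hk' : k ≠ i ∧ k ≠ j := by simpa using hk
    simp [relPosition, position_single, hk'.1, hk'.2]

lemma manyBody_density (hB : 0 < B) {ℓ : ℕ} (W : 𝓢'(Config ℓ, ℂ))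
    (hφ : ∀ i, φ ∈ particleLevel B n i) (hψ : ∀ i, ψ ∈ particleLevel B n i) :
    manyBody N W (density φ ψ) = manyBody N (laguerreLaplacianProd B n ℓ W)
      (density (listDown B n (List.finRange N) φ) (listDown B n (List.finRange N) ψ)) := by
  rw [manyBody, manyBody, sum_tempered_apply, sum_tempered_apply]
  refine Finset.sum_congr rfl fun p _ => ?_
  obtain ⟨s, hs⟩ := p
  have hi : Function.Injective s := hs.injective
  change W (pushforward _ _ _) = laguerreLaplacianProd B n ℓ W (pushforward _ _ _)
  rw [laguerreLaplacianProd_apply, pushforward_density_eq hB (select s) (select_surjective hi)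
    -- This is the order of factors in `laguerreLaplacianProd_apply`, so the two products agree
    -- without commuting anything.
    (l := (List.finRange ℓ).reverse.map s)
    ((List.nodup_reverse.mpr (List.nodup_finRange ℓ)).map hi) ?_ hφ hψ]
  · rw [List.map_map]
    simp only [Function.comp_def, pushLaplacian_select hi]
  · intro i h k
    exact select_single_eq_zero (fun j hj => h (by simpa using ⟨j, hj⟩)) k

end Potentials

/-! ### The Gaussian -/

section Gaussian

variable {E : Type*} [NormedAddCommGroup E] [InnerProductSpace ℝ E]

/-- Combines `(1 + r)^k ≤ 2^k (1 + r^{2k})` with `t^k / k! ≤ e^t` at `t = c r²`. -/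
lemma one_add_pow_mul_exp_neg_le {c : ℝ} (hc : 0 < c) (k : ℕ) :
    ∃ C, ∀ r : ℝ, 0 ≤ r → (1 + r) ^ k * Real.exp (-(c * r ^ 2)) ≤ C := by
  refine ⟨2 ^ k * (1 + k.factorial / c ^ k), fun r hr => ?_⟩
  have h1 : (1 + r) ^ k ≤ 2 ^ k * (1 + (r ^ 2) ^ k) := by
    rcases le_total r 1 with h | h
    · calc (1 + r) ^ k ≤ 2 ^ k := by gcongr; linarith
        _ ≤ 2 ^ k * (1 + (r ^ 2) ^ k) := le_mul_of_one_le_right (by positivity)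
            (le_add_of_nonneg_right (by positivity))
    · calc (1 + r) ^ k ≤ (2 * r ^ 2) ^ k := by gcongr; nlinarith
        _ = 2 ^ k * (r ^ 2) ^ k := mul_pow _ _ _
        _ ≤ 2 ^ k * (1 + (r ^ 2) ^ k) := by gcongr; linarith
  have h2 : (r ^ 2) ^ k ≤ k.factorial / c ^ k * Real.exp (c * r ^ 2) := by
    have := Real.pow_div_factorial_le_exp (c * r ^ 2) (by positivity) k
    rw [div_le_iff₀ (by positivity), mul_pow] at this
    rw [div_mul_eq_mul_div, le_div_iff₀ (by positivity)]
    linarith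
  have h3 : 1 ≤ Real.exp (c * r ^ 2) := Real.one_le_exp (by positivity)
  rw [Real.exp_neg, ← div_eq_mul_inv, div_le_iff₀ (Real.exp_pos _)]
  calc (1 + r) ^ k ≤ 2 ^ k * (1 + (r ^ 2) ^ k) := h1
    _ ≤ 2 ^ k * (Real.exp (c * r ^ 2) + k.factorial / c ^ k * Real.exp (c * r ^ 2)) := by gcongr
    _ = _ := by ring

lemma norm_iteratedFDeriv_gaussian_le (c : ℝ) (n : ℕ) :
    ∃ (k : ℕ) (C : ℝ), 0 ≤ C ∧ ∀ x : E,
      ‖iteratedFDeriv ℝ n (fun y : E => Real.exp (-(c * ‖y‖ ^ 2))) x‖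
        ≤ C * (1 + ‖x‖) ^ k * Real.exp (-(c * ‖x‖ ^ 2)) := by
  have hq : Function.HasTemperateGrowth (fun y : E => -(c * ‖y‖ ^ 2)) := by
    have := Function.hasTemperateGrowth_norm_sq (H := E)
    fun_prop
  obtain ⟨k, C, hC, h⟩ := hq.norm_iteratedFDeriv_le_uniform n
  refine ⟨k * n, n.factorial * (1 + C) ^ n, by positivity, fun x => ?_⟩
  have h2 := norm_iteratedFDeriv_comp_le (n := n) (N := n) (g := Real.exp)
    (f := fun y : E => -(c * ‖y‖ ^ 2)) (𝕜 := ℝ) Real.contDiff_exp (hq.1.of_le (by exact_mod_cast le_top))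
    le_rfl x (C := Real.exp (-(c * ‖x‖ ^ 2))) (D := (1 + C) * (1 + ‖x‖) ^ k) ?_ ?_
  · refine h2.trans (le_of_eq ?_)
    rw [mul_pow, ← pow_mul]
    ring
  · intro i _
    rw [norm_iteratedFDeriv_eq_norm_iteratedDeriv, iteratedDeriv_eq_iterate, Real.iter_deriv_exp,
      Real.norm_of_nonneg (Real.exp_pos _).le]
  · intro i hi hin
    -- The composition bound asks for `D^i` on the `i`-th derivative with `i ≥ 1`; replacing `C` by
    -- `1 + C` ensures `D ≥ 1`, so that `D ≤ D^i`.
    have h1 : 1 ≤ (1 + C) * (1 + ‖x‖) ^ k :=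
      one_le_mul_of_one_le_of_one_le (by linarith) (one_le_pow₀ (by linarith [norm_nonneg x]))
    calc _ ≤ C * (1 + ‖x‖) ^ k := h i hin x
      _ ≤ (1 + C) * (1 + ‖x‖) ^ k := by gcongr; linarith
      _ ≤ _ := le_self_pow₀ h1 (by omega)

/-- The Gaussian `e^{-c |x|²}` as a Schwartz function. -/
def gaussianSchwartz (E : Type*) [NormedAddCommGroup E] [InnerProductSpace ℝ E] {c : ℝ}
    (hc : 0 < c) : 𝓢(E, ℂ) :=
  SchwartzMap.postcompCLM (𝕜 := ℝ) Complex.ofRealCLM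
    { toFun := fun y => Real.exp (-(c * ‖y‖ ^ 2))
      smooth' := by
        have : ContDiff ℝ ((⊤ : ℕ∞) : WithTop ℕ∞) (fun y : E => ‖y‖ ^ 2) := contDiff_norm_sq ℝ
        fun_prop
      decay' := by
        intro k n
        obtain ⟨l, C, hC, h⟩ := norm_iteratedFDeriv_gaussian_le (E := E) c n
        obtain ⟨D, hD⟩ := one_add_pow_mul_exp_neg_le hc (k + l)
        refine ⟨C * D, fun x => ?_⟩
        calc _ ≤ (1 + ‖x‖) ^ k * (C * (1 + ‖x‖) ^ l * Real.exp (-(c * ‖x‖ ^ 2))) := by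
              gcongr
              · linarith
              · exact h x
          _ = C * ((1 + ‖x‖) ^ (k + l) * Real.exp (-(c * ‖x‖ ^ 2))) := by ring
          _ ≤ C * D := by gcongr; exact hD _ (norm_nonneg x) }

lemma gaussianSchwartz_apply {c : ℝ} (hc : 0 < c) (x : E) :
    gaussianSchwartz E hc x = (Real.exp (-(c * ‖x‖ ^ 2)) : ℂ) := rfl

lemma fderiv_gaussianSchwartz {c : ℝ} (hc : 0 < c) (x v : E) :
    fderiv ℝ (gaussianSchwartz E hc) x v
      = (-(2 * c * ⟪x, v⟫_ℝ) : ℝ) * gaussianSchwartz E hc x := by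
  have h : HasFDerivAt (fun y : E => ((Real.exp (-(c * ‖y‖ ^ 2)) : ℝ) : ℂ)) _ x :=
    Complex.ofRealCLM.hasFDerivAt.comp x
      ((((hasStrictFDerivAt_norm_sq x).hasFDerivAt.const_mul c).neg).exp)
  have h2 : (gaussianSchwartz E hc : E → ℂ) = fun y : E => ((Real.exp (-(c * ‖y‖ ^ 2)) : ℝ) : ℂ) :=
    rfl
  rw [h2, h.fderiv]
  simp
  ring

end Gaussian

/-! ### Completeness of the Landau levels -/

section Completeness

variable {B : ℝ} {n : ℕ}

/-- With the exponent `B/4` the gradient of the Gaussian is `-(B/2)x` times the Gaussian, which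
cancels the coordinate part of `a`. -/
lemma gaussianSchwartz_mem (hB : 0 < B) :
    gaussianSchwartz Plane (by positivity : 0 < B / 4) ∈ schwartzLevel B (0 : Fin 2) 1 0 := by
  rw [mem_schwartzLevel]
  have h : lowering B (0 : Fin 2) 1 (gaussianSchwartz Plane (by positivity : 0 < B / 4)) = 0 := by
    ext x
    simp only [lowering, LinearMap.smul_apply, LinearMap.add_apply, LinearMap.sub_apply, smul_apply,
      add_apply, sub_apply, partialDeriv_apply, SchwartzMap.lineDerivOp_apply_eq_fderiv,
      fderiv_gaussianSchwartz, coordMul_apply, smul_eq_mul, zero_apply,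
      EuclideanSpace.inner_single_right]
    simp
    ring_nf
    try simp
  rw [h]
  simp

/-- The linear span of all Schwartz functions that are eigenfunctions of the Landau Hamiltonian. -/
def eigenSpan (B : ℝ) : Submodule ℂ 𝓢(Plane, ℂ) := ⨆ n, schwartzLevel B (0 : Fin 2) 1 n

lemma eigenSpan_le_comap {X : Module.End ℂ 𝓢(Plane, ℂ)}
    (h : ∀ n, ∀ φ ∈ schwartzLevel B (0 : Fin 2) 1 n, X φ ∈ eigenSpan B) :
    eigenSpan B ≤ (eigenSpan B).comap X :=
  iSup_le fun n φ hφ => h n φ hφ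

lemma mem_eigenSpan {φ : 𝓢(Plane, ℂ)} (h : φ ∈ schwartzLevel B (0 : Fin 2) 1 n) :
    φ ∈ eigenSpan B :=
  Submodule.mem_iSup_of_mem n h

lemma raising_mem_eigenSpan (hB : 0 < B) {φ : 𝓢(Plane, ℂ)}
    (h : φ ∈ schwartzLevel B (0 : Fin 2) 1 n) : raising B (0 : Fin 2) 1 φ ∈ eigenSpan B :=
  mem_eigenSpan (raising_mem hB (by simp) h)

lemma lowering_mem_eigenSpan (hB : 0 < B) {φ : 𝓢(Plane, ℂ)}
    (h : φ ∈ schwartzLevel B (0 : Fin 2) 1 n) : lowering B (0 : Fin 2) 1 φ ∈ eigenSpan B := by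
  cases n with
  | zero => rw [lowering_eq_zero h]; exact zero_mem _
  | succ n => exact mem_eigenSpan (lowering_mem hB (by simp) h)

lemma mem_schwartzLevel_of_commute {ι : Type*} [Fintype ι] [DecidableEq ι] {a b : ι}
    {X : Module.End ℂ 𝓢(EuclideanSpace ℝ ι, ℂ)}
    (hl : Commute X (lowering B a b)) (hr : Commute X (raising B a b))
    {φ : 𝓢(EuclideanSpace ℝ ι, ℂ)} (h : φ ∈ schwartzLevel B a b n) :
    X φ ∈ schwartzLevel B a b n :=
  Module.End.mem_eigenspace_iff.mpr (by
    rw [← Module.End.mul_apply, ← (hr.mul_right hl).eq, Module.End.mul_apply,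
      Module.End.mem_eigenspace_iff.mp h, map_smul])

/-- A coordinate is a combination of `a` and `a†`, which shift the level by one, and a
guiding-centre momentum, which preserves it. -/
lemma coordMul_mem_eigenSpan (hB : 0 < B) (k : Fin 2) {φ : 𝓢(Plane, ℂ)} (h : φ ∈ eigenSpan B) :
    coordMul k φ ∈ eigenSpan B := by
  have h01 : (0 : Fin 2) ≠ 1 := by simp
  have h0 : eigenSpan B ≤ (eigenSpan B).comap (coordMul 0) := by
    refine eigenSpan_le_comap fun n φ hφ => ?_
    rw [coordMul_fst_eq hB 0 1]
    exact add_mem (Submodule.smul_mem _ _ (mem_eigenSpan (mem_schwartzLevel_of_commute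
      (guidingY_commute_lowering B h01) (guidingY_commute_raising B h01) hφ)))
      (Submodule.smul_mem _ _ (sub_mem (lowering_mem_eigenSpan hB hφ)
        (raising_mem_eigenSpan hB hφ)))
  have h1 : eigenSpan B ≤ (eigenSpan B).comap (coordMul 1) := by
    refine eigenSpan_le_comap fun n φ hφ => ?_
    rw [coordMul_snd_eq hB 0 1]
    exact sub_mem (Submodule.smul_mem _ _ (add_mem (lowering_mem_eigenSpan hB hφ)
        (raising_mem_eigenSpan hB hφ))) (Submodule.smul_mem _ _ (mem_eigenSpan
        (mem_schwartzLevel_of_commute (guidingX_commute_lowering B h01)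
          (guidingX_commute_raising B h01) hφ)))
  fin_cases k
  · exact h0 h
  · exact h1 h

/-- These are the terms, up to constants, of the power series of a plane wave times the Gaussian. -/
lemma exists_inner_pow_mul_gaussian_mem_eigenSpan (hB : 0 < B) (t : Plane) (k : ℕ) :
    ∃ f ∈ eigenSpan B, ∀ x : Plane,
      f x = ((⟪x, t⟫_ℝ : ℝ) : ℂ) ^ k * (Real.exp (-(B / 4 * ‖x‖ ^ 2)) : ℂ) := by
  induction k with
  | zero =>
    exact ⟨_, mem_eigenSpan (gaussianSchwartz_mem hB), fun x => by
      rw [gaussianSchwartz_apply, pow_zero, one_mul]⟩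
  | succ k ih =>
    obtain ⟨f, hf, h⟩ := ih
    refine ⟨(t 0 : ℂ) • coordMul 0 f + (t 1 : ℂ) • coordMul 1 f,
      add_mem (Submodule.smul_mem _ _ (coordMul_mem_eigenSpan hB 0 hf))
        (Submodule.smul_mem _ _ (coordMul_mem_eigenSpan hB 1 hf)), fun x => ?_⟩
    have hx : ((⟪x, t⟫_ℝ : ℝ) : ℂ) = t 0 * x 0 + t 1 * x 1 := by
      simp [PiLp.inner_apply, Fin.sum_univ_two]
    rw [pow_succ, add_apply, smul_apply, smul_apply, coordMul_apply, coordMul_apply, h]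
    simp only [smul_eq_mul, hx]
    ring

end Completeness

/-! ### Vanishing Gaussian moments and uniqueness of the Fourier transform. -/

section Completeness

/-- For Schwartz `u`, moving the Fourier transform across the pairing gives `∫ g u = ∫ ĝ · 𝓕⁻u = 0`;
smooth compactly supported `u` already determine `g`. -/
lemma ae_eq_zero_of_fourier_eq_zero {E : Type*} [NormedAddCommGroup E] [InnerProductSpace ℝ E]
    [FiniteDimensional ℝ E] [MeasurableSpace E] [BorelSpace E] {g : E → ℂ} (hg : Integrable g)
    (h : ∀ t, ∫ x, Complex.exp (-(2 * Real.pi * ⟪x, t⟫_ℝ * Complex.I)) * g x = 0) :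
    g =ᵐ[volume] 0 := by
  have hF (u : 𝓢(E, ℂ)) : ∫ x, g x * u x = 0 := by
    have h1 := VectorFourier.integral_fourierIntegral_smul_eq_flip
      (e := Real.fourierChar) (μ := (volume : Measure E)) (ν := (volume : Measure E))
      (L := innerₗ E) (f := g) (g := (𝓕⁻ u : 𝓢(E, ℂ)))
      Real.continuous_fourierChar (by simpa using continuous_inner) hg
      (𝓕⁻ u : 𝓢(E, ℂ)).integrable
    have h2 (t : E) : VectorFourier.fourierIntegral Real.fourierChar (volume : Measure E)
        (innerₗ E) g t = 0 := by
      rw [← h t, VectorFourier.fourierIntegral]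
      refine integral_congr_ae (Filter.Eventually.of_forall fun x => ?_)
      simp only [innerₗ_apply_apply, Circle.smul_def, Real.fourierChar_apply, smul_eq_mul]
      congr 2
      push_cast
      ring
    have h3 (x : E) : VectorFourier.fourierIntegral Real.fourierChar (volume : Measure E)
        (innerₗ E).flip ((𝓕⁻ u : 𝓢(E, ℂ)) : E → ℂ) x = u x := by
      have h5 : 𝓕 ((𝓕⁻ u : 𝓢(E, ℂ)) : E → ℂ) x = u x := by
        rw [← SchwartzMap.fourier_coe, FourierTransform.fourier_fourierInv_eq]
      rw [← h5]
      simp [VectorFourier.fourierIntegral, Real.fourier_eq, real_inner_comm]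
    simp only [h2, h3, smul_eq_mul, zero_mul, integral_zero] at h1
    exact h1.symm
  refine ae_eq_zero_of_integral_contDiff_smul_eq_zero hg.locallyIntegrable fun u hu hc => ?_
  have hg₁ : HasCompactSupport (Complex.ofRealCLM ∘ u) := hc.comp_left rfl
  have hg₂ : ContDiff ℝ ((⊤ : ℕ∞) : WithTop ℕ∞) (Complex.ofRealCLM ∘ u) :=
    Complex.ofRealCLM.contDiff.comp hu
  rw [← hF (hg₁.toSchwartzMap hg₂)]
  refine integral_congr_ae (Filter.Eventually.of_forall fun x => ?_)
  simp [mul_comm]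

/-- Completing the square: `s‖x‖ - c‖x‖² ≤ s²/(2c) - (c/2)‖x‖²`. -/
lemma memLp_exp_norm_mul_gaussian {c : ℝ} (hc : 0 < c) (s : ℝ) :
    MemLp (fun x : Plane => Real.exp (s * ‖x‖) * Real.exp (-(c * ‖x‖ ^ 2))) 2 := by
  have h := (gaussianSchwartz Plane (half_pos hc)).memLp 2 volume
  refine (h.const_mul (Real.exp (s ^ 2 / (2 * c)) : ℂ)).mono (by fun_prop)
    (Filter.Eventually.of_forall fun x => ?_)
  rw [gaussianSchwartz_apply, ← Complex.ofReal_mul, Complex.norm_real, ← Real.exp_add,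
    ← Real.exp_add, Real.norm_of_nonneg (Real.exp_pos _).le, Real.norm_of_nonneg (Real.exp_pos _).le,
    Real.exp_le_exp]
  have h1 : s ^ 2 / (2 * c) + -(c / 2 * ‖x‖ ^ 2) - (s * ‖x‖ + -(c * ‖x‖ ^ 2))
      = (s - c * ‖x‖) ^ 2 / (2 * c) := by
    field_simp
    ring
  have h2 : 0 ≤ (s - c * ‖x‖) ^ 2 / (2 * c) := by positivity
  linarith

/-- Orthogonality makes all moments of `Gψ` vanish, with `G` the ground-state Gaussian. Summing the
exponential series under the integral, the Fourier transform of `Gψ` vanishes, and `G` has no zeros.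
-/
lemma eq_zero_of_inner_eigenSpan_eq_zero {B : ℝ} (hB : 0 < B)
    {ψ : Lp ℂ 2 (volume : Measure Plane)}
    (h : ∀ f ∈ eigenSpan B, ⟪f.toLp 2, ψ⟫_ℂ = 0) : ψ = 0 := by
  set G : Plane → ℝ := fun x => Real.exp (-(B / 4 * ‖x‖ ^ 2)) with hG
  have hGm : Continuous G := by fun_prop
  have hψm : AEStronglyMeasurable ψ volume := (Lp.memLp ψ).aestronglyMeasurable
  have hbd (s : ℝ) : Integrable (fun x => (Real.exp (s * ‖x‖) * G x) * ‖ψ x‖) :=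
    (memLp_exp_norm_mul_gaussian (by positivity : 0 < B / 4) s).integrable_mul (Lp.memLp ψ).norm
  have hmom (t : Plane) (k : ℕ) : ∫ x, ((⟪x, t⟫_ℝ : ℝ) : ℂ) ^ k * ((G x : ℂ) * ψ x) = 0 := by
    obtain ⟨f, hf, hfx⟩ := exists_inner_pow_mul_gaussian_mem_eigenSpan hB t k
    rw [← h f hf, L2.inner_def]
    refine integral_congr_ae ?_
    filter_upwards [f.coeFn_toLp 2 volume] with x hx
    rw [hx, hfx]
    simp only [RCLike.inner_apply, map_mul, map_pow, Complex.conj_ofReal, hG]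
    ring
  have hg : Integrable (fun x => (G x : ℂ) * ψ x) := by
    refine (hbd 0).mono (by fun_prop) (Filter.Eventually.of_forall fun x => ?_)
    simp
  have h0 := ae_eq_zero_of_fourier_eq_zero hg fun t => by
    have hs := hasSum_integral_of_dominated_convergence (μ := (volume : Measure Plane))
      (F := fun (k : ℕ) x => (-(2 * Real.pi * Complex.I)) ^ k / (k.factorial : ℂ) *
        (((⟪x, t⟫_ℝ : ℝ) : ℂ) ^ k * ((G x : ℂ) * ψ x)))
      (f := fun x => Complex.exp (-(2 * Real.pi * ⟪x, t⟫_ℝ * Complex.I)) * ((G x : ℂ) * ψ x))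
      -- The bounds sum to `e^{2π‖t‖‖x‖} G‖ψ‖`, which is integrable by `hbd`.
      (bound := fun k x => (2 * Real.pi * ‖t‖ * ‖x‖) ^ k / (k.factorial : ℝ) * (G x * ‖ψ x‖))
      ?_ ?_ ?_ ?_ ?_
    · refine hs.unique ?_
      convert hasSum_zero with k
      rw [integral_const_mul, hmom, mul_zero]
    · intro k
      have : Continuous fun x : Plane => ((⟪x, t⟫_ℝ : ℝ) : ℂ) ^ k := by fun_prop
      fun_prop
    · intro k
      refine Filter.Eventually.of_forall fun x => ?_
      have hin : |⟪x, t⟫_ℝ| ≤ ‖x‖ * ‖t‖ := abs_real_inner_le_norm x t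
      have hGx : 0 < G x := Real.exp_pos _
      simp only [norm_mul, norm_div, norm_pow, norm_neg, Complex.norm_I, Complex.norm_real,
        Complex.norm_natCast, Real.norm_eq_abs, Complex.norm_ofNat, mul_one, abs_of_pos Real.pi_pos,
        abs_of_pos hGx]
      rw [← mul_assoc, div_mul_eq_mul_div, ← mul_pow]
      have h2 : 2 * Real.pi * |⟪x, t⟫_ℝ| ≤ 2 * Real.pi * ‖t‖ * ‖x‖ := by
        rw [mul_assoc _ ‖t‖, mul_comm ‖t‖]
        gcongr
      exact mul_le_mul_of_nonneg_right (div_le_div_of_nonneg_right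
        (pow_le_pow_left₀ (by positivity) h2 k) (by positivity)) (by positivity)
    · exact Filter.Eventually.of_forall fun x =>
        (Real.summable_pow_div_factorial _).mul_right _
    · refine (hbd (2 * Real.pi * ‖t‖)).congr (Filter.Eventually.of_forall fun x => ?_)
      simp only
      rw [tsum_mul_right, Real.exp_eq_exp_ℝ, NormedSpace.exp_eq_tsum_div, mul_assoc]
    · refine Filter.Eventually.of_forall fun x => ?_
      have := (NormedSpace.expSeries_div_hasSum_exp
        (-(2 * Real.pi * ⟪x, t⟫_ℝ * Complex.I) : ℂ)).mul_right ((G x : ℂ) * ψ x)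
      rw [← Complex.exp_eq_exp_ℂ] at this
      have e (k : ℕ) : (-(2 * Real.pi * Complex.I)) ^ k / (k.factorial : ℂ) *
          (((⟪x, t⟫_ℝ : ℝ) : ℂ) ^ k * ((G x : ℂ) * ψ x))
          = (-(2 * Real.pi * ⟪x, t⟫_ℝ * Complex.I) : ℂ) ^ k / (k.factorial : ℂ)
            * ((G x : ℂ) * ψ x) := by
        rw [← mul_assoc, div_mul_eq_mul_div, ← mul_pow]
        congr 3
        ring
      simp only [e]
      exact this
  rw [Lp.eq_zero_iff_ae_eq_zero]
  filter_upwards [h0] with x hx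
  have hGx : (G x : ℂ) ≠ 0 := by exact_mod_cast (Real.exp_pos _).ne'
  exact (mul_eq_zero.mp hx).resolve_left hGx

end Completeness

/-! ### The Landau level as the closure of its Schwartz functions. -/

section LandauLevel

section SchwartzToL2

variable {E : Type*} [NormedAddCommGroup E] [InnerProductSpace ℝ E] [FiniteDimensional ℝ E]
  [MeasurableSpace E] [BorelSpace E]

variable (E) in
/-- The inclusion of the Schwartz functions into `L²`. -/
def toL2 : 𝓢(E, ℂ) →ₗ[ℂ] Lp ℂ 2 (volume : Measure E) :=
  (SchwartzMap.toLpCLM ℂ ℂ 2 (volume : Measure E)).toLinearMap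

lemma toL2_apply (φ : 𝓢(E, ℂ)) : toL2 E φ = φ.toLp 2 := rfl

lemma toL2_injective : Function.Injective (toL2 E) := SchwartzMap.injective_toLp 2 volume

lemma inner_toL2_ext {Φ Ψ : Lp ℂ 2 (volume : Measure E)}
    (h : ∀ χ : 𝓢(E, ℂ), ⟪toL2 E χ, Φ⟫_ℂ = ⟪toL2 E χ, Ψ⟫_ℂ) : Φ = Ψ := by
  have hd : DenseRange (toL2 E) :=
    SchwartzMap.denseRange_toLpCLM (p := 2) (by simp)
  exact hd.eq_of_inner_right ℂ h

/-- For a fixed test function both sides are continuous in `Ψ`. Weak eigenvalue equations therefore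
survive `L²` limits. -/
lemma isClosed_weak_eigenspace (X : Module.End ℂ 𝓢(E, ℂ)) (c : ℂ) :
    IsClosed {Ψ : Lp ℂ 2 (volume : Measure E) |
      ∀ χ : 𝓢(E, ℂ), ⟪toL2 E (X χ), Ψ⟫_ℂ = c * ⟪toL2 E χ, Ψ⟫_ℂ} := by
  simp only [Set.ofPred_forall]
  exact isClosed_iInter fun χ => isClosed_eq (by fun_prop) (by fun_prop)

end SchwartzToL2

variable {B m : ℝ} {n k : ℕ}

section

variable {ι : Type*} [Fintype ι] [DecidableEq ι] {a b : ι}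

lemma landauHamiltonian_of_mem (hB : 0 < B) (hab : a ≠ b)
    {φ : 𝓢(EuclideanSpace ℝ ι, ℂ)} (h : φ ∈ schwartzLevel B a b n) :
    landauHamiltonian B m a b φ = (levelEnergy B m n : ℂ) • φ := by
  rw [landauHamiltonian_eq hB hab, mem_schwartzLevel.mp h, smul_smul, ← add_smul, levelEnergy]
  congr 1
  push_cast
  rw [mul_comm (2 : ℂ), ← div_div]
  ring

lemma inner_numberOp (φ ψ : 𝓢(EuclideanSpace ℝ ι, ℂ)) :
    ⟪toL2 _ (raising B a b (lowering B a b φ)), toL2 _ ψ⟫_ℂ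
      = ⟪toL2 _ φ, toL2 _ (raising B a b (lowering B a b ψ))⟫_ℂ := by
  simp only [toL2_apply]
  rw [inner_raising_left, inner_lowering_left]

lemma inner_landauHamiltonian (hB : 0 < B) (hab : a ≠ b) (φ ψ : 𝓢(EuclideanSpace ℝ ι, ℂ)) :
    ⟪toL2 _ (landauHamiltonian B m a b φ), toL2 _ ψ⟫_ℂ
      = ⟪toL2 _ φ, toL2 _ (landauHamiltonian B m a b ψ)⟫_ℂ := by
  rw [landauHamiltonian_eq hB hab, landauHamiltonian_eq hB hab]
  simp only [map_add, map_smul, inner_add_left, inner_add_right, inner_smul_left, inner_smul_right,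
    inner_numberOp]
  simp [Complex.conj_ofNat]

end

lemma toL2_mem_landauLevel (hB : 0 < B) {φ : 𝓢(Plane, ℂ)}
    (h : φ ∈ schwartzLevel B (0 : Fin 2) 1 n) : toL2 Plane φ ∈ landauLevel B m n := by
  intro χ
  change ⟪toL2 Plane (landauHamiltonian B m 0 1 χ), _⟫_ℂ = _
  rw [inner_landauHamiltonian hB (by simp), landauHamiltonian_of_mem hB (by simp) h, map_smul,
    inner_smul_right]
  rfl

lemma inner_eq_zero_of_mem_landauLevel (hB : 0 < B) (hm : 0 < m) {φ : 𝓢(Plane, ℂ)}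
    (h : φ ∈ schwartzLevel B (0 : Fin 2) 1 k) (hkn : k ≠ n) {ψ : Lp ℂ 2 (volume : Measure Plane)}
    (hψ : ψ ∈ landauLevel B m n) : ⟪toL2 Plane φ, ψ⟫_ℂ = 0 := by
  have h1 : ⟪toL2 Plane (landauHamiltonian B m 0 1 φ), ψ⟫_ℂ
      = (levelEnergy B m n : ℂ) * ⟪toL2 Plane φ, ψ⟫_ℂ := hψ φ
  rw [landauHamiltonian_of_mem hB (by simp) h, map_smul, inner_smul_left, Complex.conj_ofReal,
    mul_eq_mul_right_iff] at h1
  refine h1.resolve_left fun h2 => hkn ?_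
  have h3 : levelEnergy B m k = levelEnergy B m n := by exact_mod_cast h2
  have h4 : B / m ≠ 0 := by positivity
  have h5 := mul_right_cancel₀ h4 h3
  exact_mod_cast add_right_cancel h5

/-- The component `q` of a state orthogonal to the closure still lies in the level. It is orthogonal
to the Schwartz functions of level `n` by construction and to those of the other levels because the
energies differ, so completeness gives `q = 0`. -/
lemma landauLevel_eq_closure (hB : 0 < B) (hm : 0 < m) (n : ℕ) :
    landauLevel B m n
      = ((schwartzLevel B (0 : Fin 2) 1 n).map (toL2 Plane)).topologicalClosure := by
  set K := ((schwartzLevel B (0 : Fin 2) 1 n).map (toL2 Plane)).topologicalClosure with hK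
  have hle : K ≤ landauLevel B m n := by
    refine Submodule.topologicalClosure_minimal _ ?_ ?_
    · rintro _ ⟨φ, hφ, rfl⟩
      exact toL2_mem_landauLevel hB hφ
    · exact isClosed_weak_eigenspace (E := Plane) (landauHamiltonian B m 0 1).toLinearMap _
  refine le_antisymm (fun ψ hψ => ?_) hle
  have : CompleteSpace K := (Submodule.isClosed_topologicalClosure _).completeSpace_coe
  obtain ⟨p, hp, q, hq, rfl⟩ := K.exists_add_mem_mem_orthogonal ψ
  suffices q = 0 by rwa [this, add_zero]
  have hqL : q ∈ landauLevel B m n := by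
    have := sub_mem hψ (hle hp)
    rwa [add_sub_cancel_left] at this
  refine eq_zero_of_inner_eigenSpan_eq_zero hB fun f hf => ?_
  induction hf using Submodule.iSup_induction' with
  | mem k φ hφ =>
    by_cases hkn : k = n
    · subst hkn
      exact hq _ (Submodule.le_topologicalClosure _ (Submodule.mem_map_of_mem hφ))
    · exact inner_eq_zero_of_mem_landauLevel hB hm hφ hkn hqL
  | zero => exact (congrArg (fun u => ⟪u, q⟫_ℂ) (map_zero (toL2 Plane))).trans (inner_zero_left _)
  | add x y _ _ hx hy =>
    change ⟪toL2 Plane (x + y), q⟫_ℂ = 0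
    rw [map_add, inner_add_left]
    exact (congrArg₂ (· + ·) hx hy).trans (add_zero 0)

end LandauLevel

/-! ### Tensor products of Schwartz functions -/

section TensorSchwartz

variable {N : ℕ}

lemma one_add_sum_le_prod_one_add {κ : Type*} (s : Finset κ) {a : κ → ℝ} (ha : ∀ i, 0 ≤ a i) :
    1 + ∑ i ∈ s, a i ≤ ∏ i ∈ s, (1 + a i) := by
  classical
  induction s using Finset.induction_on with
  | empty => simp
  | insert i s hi ih =>
    rw [Finset.sum_insert hi, Finset.prod_insert hi]
    have h1 : 0 ≤ ∑ i ∈ s, a i := Finset.sum_nonneg fun i _ => ha i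
    nlinarith [ha i]

/-- A weight in product form can be distributed over the factors of a tensor product, each of which
absorbs its own share. -/
lemma norm_config_le (r : Config N) : ‖r‖ ≤ ∏ j, (1 + ‖position j r‖) := by
  have h1 : ‖r‖ ^ 2 = ∑ j, ‖position j r‖ ^ 2 := by
    rw [EuclideanSpace.norm_sq_eq, Fintype.sum_prod_type]
    simp only [EuclideanSpace.norm_sq_eq, position_apply]
  have h2 : ‖r‖ ^ 2 ≤ (∑ j, ‖position j r‖) ^ 2 := by
    rw [h1]
    exact Finset.sum_sq_le_sq_sum_of_nonneg fun _ _ => norm_nonneg _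
  have h3 := abs_le_of_sq_le_sq h2 (Finset.sum_nonneg fun _ _ => norm_nonneg _)
  have h4 := one_add_sum_le_prod_one_add Finset.univ (fun j => norm_nonneg (position j r))
  linarith [le_abs_self ‖r‖]

lemma exists_bound_iteratedFDeriv_comp_position (ψ : 𝓢(Plane, ℂ)) (j : Fin N) (k n : ℕ) :
    ∃ C, ∀ r : Config N, (1 + ‖position j r‖) ^ k *
      ‖iteratedFDeriv ℝ n (fun r : Config N => ψ (position j r)) r‖ ≤ C := by
  refine ⟨2 ^ k * ((Finset.Iic (k, n)).sup fun m => SchwartzMap.seminorm ℝ m.1 m.2) ψ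
    * ∏ _i : Fin n, ‖(position j : Config N →L[ℝ] Plane)‖, fun r => ?_⟩
  have h1 : iteratedFDeriv ℝ n (fun r : Config N => ψ (position j r)) r
      = (iteratedFDeriv ℝ n ψ (position j r)).compContinuousLinearMap fun _ => position j :=
    ContinuousLinearMap.iteratedFDeriv_comp_right (position j) (ψ.smooth n) r le_rfl
  rw [h1]
  calc _ ≤ (1 + ‖position j r‖) ^ k * (‖iteratedFDeriv ℝ n ψ (position j r)‖ *
        ∏ _i : Fin n, ‖(position j : Config N →L[ℝ] Plane)‖) := by
        gcongr
        exact ContinuousMultilinearMap.norm_compContinuousLinearMap_le _ _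
    _ ≤ _ := by
        rw [← mul_assoc]
        refine mul_le_mul_of_nonneg_right ?_ (by positivity)
        exact SchwartzMap.one_add_le_sup_seminorm_apply (𝕜 := ℝ) (m := (k, n)) le_rfl le_rfl ψ _

lemma decay_tensor (ψ : Fin N → 𝓢(Plane, ℂ)) (k n : ℕ) :
    ∃ C, ∀ r : Config N, ‖r‖ ^ k *
      ‖iteratedFDeriv ℝ n (fun r : Config N => ∏ j, ψ j (position j r)) r‖ ≤ C := by
  classical
  choose C hC using fun (j : Fin N) (c : ℕ) => exists_bound_iteratedFDeriv_comp_position (ψ j) j k c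
  refine ⟨∑ p ∈ (Finset.univ : Finset (Fin N)).sym n, ((p : Multiset (Fin N)).countPerms : ℝ) *
    ∏ j, C j ((p : Multiset (Fin N)).count j), fun r => ?_⟩
  have h1 := norm_iteratedFDeriv_prod_le (𝕜 := ℝ) (u := Finset.univ) (N := n)
    (f := fun (j : Fin N) (r : Config N) => ψ j (position j r))
    (fun j _ => ((ψ j).smooth n).comp (position j).contDiff) (x := r) (n := n) le_rfl
  calc _ ≤ (∏ j, (1 + ‖position j r‖)) ^ k * ∑ p ∈ (Finset.univ : Finset (Fin N)).sym n,
        ((p : Multiset (Fin N)).countPerms : ℝ) * ∏ j,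
          ‖iteratedFDeriv ℝ ((p : Multiset (Fin N)).count j)
            (fun r : Config N => ψ j (position j r)) r‖ := by
        gcongr
        exact norm_config_le r
    _ = ∑ p ∈ (Finset.univ : Finset (Fin N)).sym n,
        ((p : Multiset (Fin N)).countPerms : ℝ) * ∏ j, ((1 + ‖position j r‖) ^ k *
          ‖iteratedFDeriv ℝ ((p : Multiset (Fin N)).count j)
            (fun r : Config N => ψ j (position j r)) r‖) := by
        rw [Finset.mul_sum]
        refine Finset.sum_congr rfl fun p _ => ?_
        rw [Finset.prod_mul_distrib, Finset.prod_pow]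
        ring
    _ ≤ _ := by
        gcongr with p hp j hj
        exact hC j _ r

/-- The tensor product `∏_j ψ_j(r_j)` of one-particle Schwartz functions. -/
def tensorFun (ψ : Fin N → 𝓢(Plane, ℂ)) : 𝓢(Config N, ℂ) where
  toFun r := ∏ j, ψ j (position j r)
  smooth' := contDiff_prod fun j _ => ((ψ j).smooth _).comp (position j).contDiff
  decay' := decay_tensor ψ

lemma tensorFun_apply (ψ : Fin N → 𝓢(Plane, ℂ)) (r : Config N) :
    tensorFun ψ r = ∏ j, ψ j (position j r) := rfl

lemma prod_update_position (ψ : Fin N → 𝓢(Plane, ℂ)) (i : Fin N) (f : 𝓢(Plane, ℂ)) (r : Config N) :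
    ∏ j, Function.update ψ i f j (position j r)
      = f (position i r) * ∏ j ∈ Finset.univ.erase i, ψ j (position j r) := by
  rw [← Finset.mul_prod_erase Finset.univ _ (Finset.mem_univ i), Function.update_self]
  congr 1
  refine Finset.prod_congr rfl fun j hj => ?_
  rw [Function.update_of_ne (Finset.ne_of_mem_erase hj)]

/-- The tensor product of one-particle Schwartz functions as a multilinear map. -/
def tensorSchwartz : MultilinearMap ℂ (fun _ : Fin N => 𝓢(Plane, ℂ)) 𝓢(Config N, ℂ) where
  toFun := tensorFun
  map_update_add' := by
    intro inst ψ i f g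
    -- Multilinearity is demanded for every decidability instance, while `prod_update_position` uses
    -- the canonical one.
    obtain rfl : inst = instDecidableEqFin N := Subsingleton.elim _ _
    ext r
    simp only [add_apply, tensorFun_apply, prod_update_position, add_mul]
  map_update_smul' := by
    intro inst ψ i c f
    obtain rfl : inst = instDecidableEqFin N := Subsingleton.elim _ _
    ext r
    simp only [smul_apply, tensorFun_apply, prod_update_position, smul_eq_mul, mul_assoc]

lemma tensorSchwartz_apply (ψ : Fin N → 𝓢(Plane, ℂ)) (r : Config N) :
    tensorSchwartz ψ r = ∏ j, ψ j (position j r) := rfl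

lemma coordMul_tensorSchwartz (ψ : Fin N → 𝓢(Plane, ℂ)) (i : Fin N) (k : Fin 2) :
    coordMul (i, k) (tensorSchwartz ψ)
      = tensorSchwartz (Function.update ψ i (coordMul k (ψ i))) := by
  ext r
  rw [coordMul_apply, tensorSchwartz_apply, tensorSchwartz_apply, prod_update_position,
    coordMul_apply, ← Finset.mul_prod_erase Finset.univ _ (Finset.mem_univ i), mul_assoc,
    position_apply]

lemma partialDeriv_tensorSchwartz (ψ : Fin N → 𝓢(Plane, ℂ)) (i : Fin N) (k : Fin 2) :
    partialDeriv (i, k) (tensorSchwartz ψ)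
      = tensorSchwartz (Function.update ψ i (partialDeriv k (ψ i))) := by
  ext r
  have h : HasFDerivAt (fun r : Config N => ∏ j, ψ j (position j r)) _ r :=
    HasFDerivAt.finsetProd (u := Finset.univ) (g := fun j (r : Config N) => ψ j (position j r))
      fun j _ => ((ψ j).hasFDerivAt (position j r)).comp r (position j).hasFDerivAt
  rw [partialDeriv_apply, SchwartzMap.lineDerivOp_apply_eq_fderiv, tensorSchwartz_apply,
    prod_update_position, partialDeriv_apply, SchwartzMap.lineDerivOp_apply_eq_fderiv]
  have h2 : (tensorSchwartz ψ : Config N → ℂ) = fun r => ∏ j, ψ j (position j r) := rfl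
  rw [h2, h.fderiv, sum_apply, Finset.sum_eq_single i]
  · simp [position_single, mul_comm]
  · intro j _ hj
    simp [position_single, Ne.symm hj]
  · simp

end TensorSchwartz

/-! ### Slater determinants of Schwartz functions -/

section SlaterSchwartz

variable {N : ℕ} {B : ℝ} {n : ℕ} {i : Fin N}

/-- The operator `X` acts on tensor products as the operator `Y` on the factor `i`. -/
def ActsOn (i : Fin N) (X : Module.End ℂ 𝓢(Config N, ℂ)) (Y : Module.End ℂ 𝓢(Plane, ℂ)) : Prop :=
  ∀ ψ : Fin N → 𝓢(Plane, ℂ),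
    X (tensorSchwartz ψ) = tensorSchwartz (Function.update ψ i (Y (ψ i)))

lemma actsOn_lowering (B : ℝ) (i : Fin N) :
    ActsOn i (particleLowering B i) (lowering B (0 : Fin 2) 1) := fun ψ => by
  simp only [lowering, LinearMap.smul_apply, LinearMap.add_apply, LinearMap.sub_apply,
    MultilinearMap.map_update_smul, MultilinearMap.map_update_add, MultilinearMap.map_update_sub,
    partialDeriv_tensorSchwartz, coordMul_tensorSchwartz]

lemma actsOn_raising (B : ℝ) (i : Fin N) :
    ActsOn i (particleRaising B i) (raising B (0 : Fin 2) 1) := fun ψ => by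
  simp only [raising, LinearMap.smul_apply, LinearMap.add_apply, LinearMap.sub_apply,
    MultilinearMap.map_update_smul, MultilinearMap.map_update_add, MultilinearMap.map_update_sub,
    partialDeriv_tensorSchwartz, coordMul_tensorSchwartz]

lemma ActsOn.mul {X X' : Module.End ℂ 𝓢(Config N, ℂ)} {Y Y' : Module.End ℂ 𝓢(Plane, ℂ)}
    (h : ActsOn i X Y) (h' : ActsOn i X' Y') : ActsOn i (X * X') (Y * Y') := fun ψ => by
  rw [Module.End.mul_apply, h', h, Function.update_self, Function.update_idem, Module.End.mul_apply]

lemma ActsOn.pow {X : Module.End ℂ 𝓢(Config N, ℂ)} {Y : Module.End ℂ 𝓢(Plane, ℂ)}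
    (h : ActsOn i X Y) (k : ℕ) : ActsOn i (X ^ k) (Y ^ k) := by
  induction k with
  | zero => intro ψ; simp
  | succ k ih => rw [pow_succ, pow_succ]; exact ih.mul h

lemma ActsOn.smul {X : Module.End ℂ 𝓢(Config N, ℂ)} {Y : Module.End ℂ 𝓢(Plane, ℂ)}
    (h : ActsOn i X Y) (c : ℂ) : ActsOn i (c • X) (c • Y) := fun ψ => by
  rw [LinearMap.smul_apply, LinearMap.smul_apply, MultilinearMap.map_update_smul, h]

lemma actsOn_particleDown (B : ℝ) (n : ℕ) (i : Fin N) :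
    ActsOn i (particleDown B n i) (levelDown B (0 : Fin 2) 1 n) :=
  ((actsOn_lowering B i).pow n).smul _

lemma actsOn_particleUp (B : ℝ) (n : ℕ) (i : Fin N) :
    ActsOn i (particleUp B n i) (levelUp B (0 : Fin 2) 1 n) :=
  ((actsOn_raising B i).pow n).smul _

lemma list_prod_tensorSchwartz {X : Fin N → Module.End ℂ 𝓢(Config N, ℂ)}
    {Y : Module.End ℂ 𝓢(Plane, ℂ)} (h : ∀ i, ActsOn i (X i) Y) {l : List (Fin N)} (hl : l.Nodup)
    (ψ : Fin N → 𝓢(Plane, ℂ)) :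
    (l.map X).prod (tensorSchwartz ψ)
      = tensorSchwartz fun j => if j ∈ l then Y (ψ j) else ψ j := by
  induction l with
  | nil => simp
  | cons i l ih =>
    obtain ⟨hi, hl⟩ := List.nodup_cons.mp hl
    rw [List.map_cons, List.prod_cons, Module.End.mul_apply, ih hl, h i]
    congr 1
    ext1 j
    by_cases hj : j = i
    · subst hj
      simp [hi]
    · simp [hj]

lemma list_prod_finRange_tensorSchwartz {X : Fin N → Module.End ℂ 𝓢(Config N, ℂ)}
    {Y : Module.End ℂ 𝓢(Plane, ℂ)} (h : ∀ i, ActsOn i (X i) Y) (ψ : Fin N → 𝓢(Plane, ℂ)) :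
    ((List.finRange N).map X).prod (tensorSchwartz ψ) = tensorSchwartz fun j => Y (ψ j) := by
  rw [list_prod_tensorSchwartz h (List.nodup_finRange N)]
  simp

/-- The Slater determinant `det (ψ_i(r_j))` of one-particle Schwartz functions. -/
def slaterSchwartz (ψ : Fin N → 𝓢(Plane, ℂ)) : 𝓢(Config N, ℂ) :=
  ∑ σ : Equiv.Perm (Fin N), ((Equiv.Perm.sign σ : ℤ) : ℂ) • tensorSchwartz (fun j => ψ (σ j))

/-- The linear span of the Slater determinants of Schwartz functions in the `n`-th Landau level. -/
def slaterSpan (B : ℝ) (n N : ℕ) : Submodule ℂ 𝓢(Config N, ℂ) :=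
  Submodule.span ℂ
    {Ψ | ∃ ψ : Fin N → 𝓢(Plane, ℂ), (∀ i, ψ i ∈ schwartzLevel B (0 : Fin 2) 1 n) ∧
      slaterSchwartz ψ = Ψ}

lemma tensorSchwartz_mem_particleLevel {ψ : Fin N → 𝓢(Plane, ℂ)}
    (h : ∀ i, ψ i ∈ schwartzLevel B (0 : Fin 2) 1 n) (i : Fin N) :
    tensorSchwartz ψ ∈ particleLevel B n i := by
  have h1 := (actsOn_raising B i).mul (actsOn_lowering B i) ψ
  have h2 : (raising B (0 : Fin 2) 1 * lowering B (0 : Fin 2) 1) (ψ i) = (n : ℂ) • ψ i :=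
    Module.End.mem_eigenspace_iff.mp (h i)
  rw [h2, MultilinearMap.map_update_smul, Function.update_eq_self] at h1
  exact Module.End.mem_eigenspace_iff.mpr h1

lemma slaterSpan_le_particleLevel (i : Fin N) : slaterSpan B n N ≤ particleLevel B n i := by
  refine Submodule.span_le.mpr ?_
  rintro _ ⟨ψ, hψ, rfl⟩
  exact sum_mem fun σ _ => Submodule.smul_mem _ _
    (tensorSchwartz_mem_particleLevel (fun j => hψ (σ j)) i)

lemma list_prod_slaterSchwartz {X : Fin N → Module.End ℂ 𝓢(Config N, ℂ)}
    {Y : Module.End ℂ 𝓢(Plane, ℂ)} (h : ∀ i, ActsOn i (X i) Y) (ψ : Fin N → 𝓢(Plane, ℂ)) :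
    ((List.finRange N).map X).prod (slaterSchwartz ψ) = slaterSchwartz fun j => Y (ψ j) := by
  simp only [slaterSchwartz, map_sum, map_smul, list_prod_finRange_tensorSchwartz h]

lemma listDown_mem_slaterSpan (hB : 0 < B) {φ : 𝓢(Config N, ℂ)} (h : φ ∈ slaterSpan B n N) :
    listDown B n (List.finRange N) φ ∈ slaterSpan B 0 N := by
  suffices slaterSpan B n N ≤ (slaterSpan B 0 N).comap (listDown B n (List.finRange N)) from this h
  refine Submodule.span_le.mpr ?_
  rintro _ ⟨ψ, hψ, rfl⟩
  exact Submodule.subset_span ⟨_, fun i => levelDown_mem hB (by simp) (hψ i),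
    (list_prod_slaterSchwartz (actsOn_particleDown B n) ψ).symm⟩

lemma listUp_mem_slaterSpan (hB : 0 < B) {φ : 𝓢(Config N, ℂ)} (h : φ ∈ slaterSpan B 0 N) :
    listUp B n (List.finRange N) φ ∈ slaterSpan B n N := by
  suffices slaterSpan B 0 N ≤ (slaterSpan B n N).comap (listUp B n (List.finRange N)) from this h
  refine Submodule.span_le.mpr ?_
  rintro _ ⟨ψ, hψ, rfl⟩
  exact Submodule.subset_span ⟨_, fun i => levelUp_mem hB (by simp) (hψ i),
    (list_prod_slaterSchwartz (actsOn_particleUp B n) ψ).symm⟩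

end SlaterSchwartz

/-! ### Tensor products of square-integrable functions -/

section TensorL2

variable {N : ℕ}

/-- The one-particle positions, as a linear isomorphism. -/
def positionsEquiv (N : ℕ) : Config N ≃L[ℝ] (Fin N → Plane) :=
  LinearEquiv.toContinuousLinearEquiv
    { toFun := fun r j => position j r
      invFun := fun q => WithLp.toLp 2 fun jk => q jk.1 jk.2
      map_add' := fun _ _ => rfl
      map_smul' := fun _ _ => rfl
      left_inv := fun _ => rfl
      right_inv := fun _ => rfl }

lemma positionsEquiv_apply (r : Config N) (j : Fin N) : positionsEquiv N r j = position j r := rfl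

/-- Uniqueness of Haar measure. The value of the constant plays no role; its finiteness suffices for
the bounds below. -/
lemma exists_map_positionsEquiv_eq (N : ℕ) : ∃ c : NNReal,
    Measure.map (positionsEquiv N) volume = c • (volume : Measure (Fin N → Plane)) := by
  have : (Measure.map (positionsEquiv N) (volume : Measure (Config N))).IsAddHaarMeasure :=
    ContinuousLinearEquiv.isAddHaarMeasure_map _ _
  exact ⟨_, Measure.isAddLeftInvariant_eq_smul _ _⟩

/-- The ratio of the volume of the configuration space and the product of the volumes of the
planes. -/
def volumeRatio (N : ℕ) : NNReal := (exists_map_positionsEquiv_eq N).choose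

lemma map_positionsEquiv (N : ℕ) : Measure.map (positionsEquiv N) volume
    = volumeRatio N • (volume : Measure (Fin N → Plane)) :=
  (exists_map_positionsEquiv_eq N).choose_spec

lemma measurableEmbedding_positionsEquiv (N : ℕ) : MeasurableEmbedding (positionsEquiv N) :=
  (positionsEquiv N).toHomeomorph.measurableEmbedding

lemma quasiMeasurePreserving_position (j : Fin N) :
    Measure.QuasiMeasurePreserving (position j : Config N → Plane) volume volume := by
  have h1 : Measure.QuasiMeasurePreserving (positionsEquiv N) volume
      (volume : Measure (Fin N → Plane)) :=
    ⟨(positionsEquiv N).continuous.measurable, by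
      rw [map_positionsEquiv]
      exact Measure.smul_absolutelyContinuous⟩
  exact (Measure.quasiMeasurePreserving_eval (fun _ : Fin N => (volume : Measure Plane)) j).comp h1

lemma aestronglyMeasurable_tensor {f : Fin N → Plane → ℂ}
    (hf : ∀ j, AEStronglyMeasurable (f j) volume) :
    AEStronglyMeasurable (fun r : Config N => ∏ j, f j (position j r)) volume :=
  Finset.aestronglyMeasurable_fun_prod _ fun j _ =>
    (hf j).comp_quasiMeasurePreserving (quasiMeasurePreserving_position j)

lemma integrable_sq_norm_tensor {f : Fin N → Plane → ℂ}
    (hf : ∀ j, Integrable fun x => ‖f j x‖ ^ 2) :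
    Integrable (fun r : Config N => ‖∏ j, f j (position j r)‖ ^ 2) := by
  have h1 : Integrable (fun q : Fin N → Plane => ∏ j, ‖f j (q j)‖ ^ 2) :=
    Integrable.fintype_prod hf
  have h2 : Integrable (fun q : Fin N → Plane => ∏ j, ‖f j (q j)‖ ^ 2)
      (Measure.map (positionsEquiv N) volume) := by
    rw [map_positionsEquiv]
    exact h1.smul_measure_nnreal
  rw [(measurableEmbedding_positionsEquiv N).integrable_map_iff] at h2
  refine h2.congr (Filter.Eventually.of_forall fun r => ?_)
  simp only [Function.comp_apply, norm_prod, Finset.prod_pow, positionsEquiv_apply]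

lemma integral_sq_norm_tensor (f : Fin N → Plane → ℂ) :
    ∫ r : Config N, ‖∏ j, f j (position j r)‖ ^ 2
      = volumeRatio N * ∏ j, ∫ x, ‖f j x‖ ^ 2 := by
  have h1 : ∫ q : Fin N → Plane, ∏ j, ‖f j (q j)‖ ^ 2 = ∏ j, ∫ x, ‖f j x‖ ^ 2 :=
    integral_fintype_prod_volume_eq_prod (𝕜 := ℝ) fun j x => ‖f j x‖ ^ 2
  rw [← h1]
  have h2 := (measurableEmbedding_positionsEquiv N).integral_map (μ := volume)
    (fun q : Fin N → Plane => ∏ j, ‖f j (q j)‖ ^ 2)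
  rw [map_positionsEquiv, integral_smul_nnreal_measure] at h2
  simp only [norm_prod, ← Finset.prod_pow]
  exact h2.symm

lemma norm_sq_eq_integral {E : Type*} [MeasureSpace E] (f : Lp ℂ 2 (volume : Measure E)) :
    ‖f‖ ^ 2 = ∫ x, ‖f x‖ ^ 2 := by
  have h := L2.inner_def (𝕜 := ℂ) f f
  rw [inner_self_eq_norm_sq_to_K] at h
  have h2 : ∫ x, ⟪f x, f x⟫_ℂ = ((∫ x, ‖f x‖ ^ 2 : ℝ) : ℂ) := by
    rw [← integral_complex_ofReal]
    refine integral_congr_ae (Filter.Eventually.of_forall fun x => ?_)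
    simp only
    rw [inner_self_eq_norm_sq_to_K]
    norm_cast
  rw [h2] at h
  exact Complex.ofReal_injective ((Complex.ofReal_pow _ _).trans h)

lemma memLp_tensor (f : Fin N → Lp ℂ 2 (volume : Measure Plane)) :
    MemLp (fun r : Config N => ∏ j, f j (position j r)) 2 volume := by
  refine (memLp_two_iff_integrable_sq_norm
    (aestronglyMeasurable_tensor fun j => (Lp.memLp (f j)).aestronglyMeasurable)).mpr ?_
  exact integrable_sq_norm_tensor fun j => (memLp_two_iff_integrable_sq_norm
    (Lp.memLp (f j)).aestronglyMeasurable).mp (Lp.memLp (f j))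

/-- The tensor product `∏_j f_j(r_j)` of square-integrable functions. -/
def tensorLp (f : Fin N → Lp ℂ 2 (volume : Measure Plane)) :
    Lp ℂ 2 (volume : Measure (Config N)) := (memLp_tensor f).toLp

lemma coeFn_tensorLp (f : Fin N → Lp ℂ 2 (volume : Measure Plane)) :
    tensorLp f =ᵐ[volume] fun r : Config N => ∏ j, f j (position j r) :=
  (memLp_tensor f).coeFn_toLp

lemma norm_tensorLp (f : Fin N → Lp ℂ 2 (volume : Measure Plane)) :
    ‖tensorLp f‖ = √(volumeRatio N) * ∏ j, ‖f j‖ := by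
  have h : ‖tensorLp f‖ ^ 2 = volumeRatio N * ∏ j, ‖f j‖ ^ 2 := by
    simp only [norm_sq_eq_integral, ← integral_sq_norm_tensor]
    refine integral_congr_ae ?_
    filter_upwards [coeFn_tensorLp f] with r hr
    rw [hr]
  rw [← Real.sqrt_sq (norm_nonneg (tensorLp f)), h, Real.sqrt_mul (NNReal.coe_nonneg _),
    Finset.prod_pow, Real.sqrt_sq (Finset.prod_nonneg fun _ _ => norm_nonneg _)]

lemma tensorLp_congr {f : Fin N → Lp ℂ 2 (volume : Measure Plane)} {g : Fin N → Plane → ℂ}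
    (h : ∀ j, f j =ᵐ[volume] g j) :
    tensorLp f =ᵐ[volume] fun r : Config N => ∏ j, g j (position j r) := by
  have h1 : ∀ᵐ r : Config N, ∀ j, f j (position j r) = g j (position j r) :=
    Filter.eventually_all.mpr fun j => (quasiMeasurePreserving_position j).ae (h j)
  filter_upwards [coeFn_tensorLp f, h1] with r hr hr1
  rw [hr]
  exact Finset.prod_congr rfl fun j _ => hr1 j

lemma toL2_tensorSchwartz (ψ : Fin N → 𝓢(Plane, ℂ)) :
    toL2 _ (tensorSchwartz ψ) = tensorLp fun j => toL2 Plane (ψ j) := by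
  refine Lp.ext (((tensorSchwartz ψ).coeFn_toLp 2 volume).trans ?_)
  exact (tensorLp_congr fun j => (ψ j).coeFn_toLp 2 volume).symm

lemma coeFn_tensorLp_update (f : Fin N → Lp ℂ 2 (volume : Measure Plane)) (i : Fin N)
    {u : Lp ℂ 2 (volume : Measure Plane)} {v : Plane → ℂ} (h : u =ᵐ[volume] v) :
    tensorLp (Function.update f i u) =ᵐ[volume] fun r : Config N =>
      v (position i r) * ∏ j ∈ Finset.univ.erase i, f j (position j r) := by
  have h1 : ∀ᵐ r : Config N, u (position i r) = v (position i r) :=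
    (quasiMeasurePreserving_position i).ae h
  filter_upwards [coeFn_tensorLp (Function.update f i u), h1] with r hr hr1
  rw [hr, ← Finset.mul_prod_erase Finset.univ _ (Finset.mem_univ i), Function.update_self, hr1]
  congr 1
  refine Finset.prod_congr rfl fun j hj => ?_
  rw [Function.update_of_ne (Finset.ne_of_mem_erase hj)]

/-- The tensor product as a continuous multilinear map on `L²`. -/
def tensorL2 (N : ℕ) : ContinuousMultilinearMap ℂ
    (fun _ : Fin N => Lp ℂ 2 (volume : Measure Plane)) (Lp ℂ 2 (volume : Measure (Config N))) :=
  MultilinearMap.mkContinuous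
    { toFun := tensorLp
      map_update_add' := by
        intro inst f i u v
        obtain rfl : inst = instDecidableEqFin N := Subsingleton.elim _ _
        refine Lp.ext ?_
        filter_upwards [coeFn_tensorLp_update f i (Lp.coeFn_add u v),
          coeFn_tensorLp_update f i (Filter.EventuallyEq.refl _ u),
          coeFn_tensorLp_update f i (Filter.EventuallyEq.refl _ v),
          Lp.coeFn_add (tensorLp (Function.update f i u)) (tensorLp (Function.update f i v))]
          with r h1 h2 h3 h4
        rw [h1, h4]
        simp only [Pi.add_apply]
        rw [h2, h3, add_mul]
      map_update_smul' := by
        intro inst f i c u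
        obtain rfl : inst = instDecidableEqFin N := Subsingleton.elim _ _
        refine Lp.ext ?_
        filter_upwards [coeFn_tensorLp_update f i (Lp.coeFn_smul c u),
          coeFn_tensorLp_update f i (Filter.EventuallyEq.refl _ u),
          Lp.coeFn_smul c (tensorLp (Function.update f i u))] with r h1 h2 h3
        rw [h1, h3]
        simp only [Pi.smul_apply, smul_eq_mul]
        rw [h2, mul_assoc] }
    (√(volumeRatio N)) fun f => (norm_tensorLp f).le

lemma tensorL2_apply (f : Fin N → Lp ℂ 2 (volume : Measure Plane)) : tensorL2 N f = tensorLp f :=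
  rfl

/-- The Slater determinant `det (f_i(r_j))` of square-integrable functions. -/
def slaterL2 (f : Fin N → Lp ℂ 2 (volume : Measure Plane)) : Lp ℂ 2 (volume : Measure (Config N)) :=
  ∑ σ : Equiv.Perm (Fin N), ((Equiv.Perm.sign σ : ℤ) : ℂ) • tensorL2 N (fun j => f (σ j))

lemma continuous_slaterL2 :
    Continuous (slaterL2 : (Fin N → Lp ℂ 2 (volume : Measure Plane)) → _) := by
  have h (σ : Equiv.Perm (Fin N)) : Continuous fun f : Fin N → Lp ℂ 2 (volume : Measure Plane) =>
      tensorL2 N fun j => f (σ j) :=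
    (tensorL2 N).cont.comp (continuous_pi fun j => continuous_apply (σ j))
  exact continuous_finsetSum _ fun σ _ => (h σ).fun_const_smul _

lemma coeFn_slaterL2 (f : Fin N → Lp ℂ 2 (volume : Measure Plane)) :
    slaterL2 f =ᵐ[volume] fun r : Config N =>
      Matrix.det (Matrix.of fun i j : Fin N => f i (position j r)) := by
  have h1 : ∀ᵐ r : Config N, ∀ σ : Equiv.Perm (Fin N),
      (((Equiv.Perm.sign σ : ℤ) : ℂ) • tensorLp fun j => f (σ j)) r
        = ((Equiv.Perm.sign σ : ℤ) : ℂ) * ∏ j, f (σ j) (position j r) := by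
    refine Filter.eventually_all.mpr fun σ => ?_
    filter_upwards [Lp.coeFn_smul ((Equiv.Perm.sign σ : ℤ) : ℂ) (tensorLp fun j => f (σ j)),
      coeFn_tensorLp fun j => f (σ j)] with r h1 h2
    rw [h1, Pi.smul_apply, h2, smul_eq_mul]
  filter_upwards [h1, Lp.coeFn_finsetSum Finset.univ fun σ : Equiv.Perm (Fin N) =>
    ((Equiv.Perm.sign σ : ℤ) : ℂ) • tensorLp fun j => f (σ j)] with r h1 h2
  rw [Matrix.det_apply']
  refine h2.trans ?_
  rw [Finset.sum_apply]
  exact Finset.sum_congr rfl fun σ _ => h1 σ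

lemma toL2_slaterSchwartz (ψ : Fin N → 𝓢(Plane, ℂ)) :
    toL2 _ (slaterSchwartz ψ) = slaterL2 fun j => toL2 Plane (ψ j) := by
  simp only [slaterSchwartz, map_sum, map_smul, toL2_tensorSchwartz, slaterL2, tensorL2_apply]

lemma slaterStates_eq (B m : ℝ) (n N : ℕ) :
    slaterStates B m n N
      = slaterL2 '' (Set.univ.pi fun _ => (landauLevel B m n : Set (Lp ℂ 2 (volume : Measure Plane)))) := by
  ext Ψ
  constructor
  · rintro ⟨ψ, hψ, h⟩
    exact ⟨ψ, fun i _ => hψ i, Lp.ext ((coeFn_slaterL2 ψ).trans (Filter.EventuallyEq.symm h))⟩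
  · rintro ⟨ψ, hψ, rfl⟩
    exact ⟨ψ, fun i => hψ i (Set.mem_univ i), coeFn_slaterL2 ψ⟩

/-- A Slater determinant depends continuously on its orbitals, and each orbital is a limit of
Schwartz functions of the same level. -/
lemma landauLevelN_eq_closure {B m : ℝ} (hB : 0 < B) (hm : 0 < m) (n N : ℕ) :
    landauLevelN B m n N = ((slaterSpan B n N).map (toL2 (Config N))).topologicalClosure := by
  refine le_antisymm (Submodule.topologicalClosure_minimal _ (Submodule.span_le.mpr ?_)
    (Submodule.isClosed_topologicalClosure _)) (Submodule.topologicalClosure_mono ?_)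
  · rw [slaterStates_eq, landauLevel_eq_closure hB hm, Submodule.topologicalClosure_coe,
      ← closure_pi_set]
    refine (image_closure_subset_closure_image continuous_slaterL2).trans (closure_mono ?_)
    rintro _ ⟨f, hf, rfl⟩
    choose ψ hψ hψf using fun i => hf i (Set.mem_univ i)
    refine ⟨slaterSchwartz ψ, Submodule.subset_span ⟨ψ, hψ, rfl⟩, ?_⟩
    rw [toL2_slaterSchwartz]
    simp only [hψf]
  · rw [slaterSpan, Submodule.map_span]
    refine Submodule.span_mono ?_
    rintro _ ⟨_, ⟨ψ, hψ, rfl⟩, rfl⟩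
    rw [slaterStates_eq, toL2_slaterSchwartz]
    exact ⟨_, fun i _ => toL2_mem_landauLevel hB (hψ i), rfl⟩

end TensorL2

/-! ### The unitary map between the Landau levels -/

section Unitary

variable {B m : ℝ} {n N : ℕ}

/-- A Schwartz function in the closure need not be a finite combination of Schwartz Slater
determinants. The weak eigenvalue equation of each number operator passes to the limit, and for a
Schwartz function it is the strong one. -/
lemma mem_particleLevel_of_toL2_mem (hB : 0 < B) (hm : 0 < m) {φ : 𝓢(Config N, ℂ)}
    (h : toL2 _ φ ∈ landauLevelN B m n N) (i : Fin N) : φ ∈ particleLevel B n i := by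
  rw [landauLevelN_eq_closure hB hm] at h
  have h1 := (isClosed_weak_eigenspace (raising B (i, 0) (i, 1) * lowering B (i, 0) (i, 1))
    (n : ℂ)).closure_subset_iff.mpr (by
      rintro _ ⟨ψ, hψ, rfl⟩ χ
      rw [Module.End.mul_apply, inner_numberOp,
        mem_schwartzLevel.mp (slaterSpan_le_particleLevel i hψ), map_smul, inner_smul_right]) h
  refine mem_schwartzLevel.mpr (toL2_injective (inner_toL2_ext fun χ => ?_))
  rw [← inner_numberOp, map_smul, inner_smul_right]
  exact h1 χ

instance : CompleteSpace (landauLevelN B m n N) :=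
  (Submodule.isClosed_topologicalClosure _).completeSpace_coe

lemma toL2_mem_landauLevelN (hB : 0 < B) (hm : 0 < m) {φ : 𝓢(Config N, ℂ)}
    (h : φ ∈ slaterSpan B n N) : toL2 _ φ ∈ landauLevelN B m n N := by
  rw [landauLevelN_eq_closure hB hm]
  exact Submodule.le_topologicalClosure _ (Submodule.mem_map_of_mem h)

/-- The embedding of the combinations of Slater determinants of Schwartz functions. -/
def slaterEmbedding (hB : 0 < B) (hm : 0 < m) (n N : ℕ) :
    slaterSpan B n N →ₗ[ℂ] landauLevelN B m n N :=
  ((toL2 (Config N)).domRestrict (slaterSpan B n N)).codRestrict _ fun φ =>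
    toL2_mem_landauLevelN hB hm φ.2

lemma coe_slaterEmbedding (hB : 0 < B) (hm : 0 < m) (φ : slaterSpan B n N) :
    (slaterEmbedding hB hm n N φ : Lp ℂ 2 (volume : Measure (Config N))) = toL2 _ φ.1 := rfl

lemma denseRange_slaterEmbedding (hB : 0 < B) (hm : 0 < m) :
    DenseRange (slaterEmbedding hB hm n N) := by
  rw [DenseRange, Subtype.dense_iff]
  intro Ψ hΨ
  rw [SetLike.mem_coe, landauLevelN_eq_closure hB hm] at hΨ
  refine closure_mono ?_ hΨ
  rintro _ ⟨ψ, hψ, rfl⟩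
  exact ⟨_, ⟨⟨ψ, hψ⟩, rfl⟩, rfl⟩

/-- Lowering all particles from the `n`-th to the lowest Landau level. -/
def slaterEquiv (hB : 0 < B) (n N : ℕ) : slaterSpan B n N ≃ₗ[ℂ] slaterSpan B 0 N :=
  LinearEquiv.ofLinearMap
    ((listDown B n (List.finRange N)).restrict fun _ h => listDown_mem_slaterSpan hB h)
    ((listUp B n (List.finRange N)).restrict fun _ h => listUp_mem_slaterSpan hB h)
    (LinearMap.ext fun φ => Subtype.ext (listDown_listUp hB (List.nodup_finRange N) fun i _ =>
      slaterSpan_le_particleLevel i φ.2))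
    (LinearMap.ext fun φ => Subtype.ext (listUp_listDown hB (List.nodup_finRange N) fun i _ =>
      slaterSpan_le_particleLevel i φ.2))

lemma coe_slaterEquiv (hB : 0 < B) (φ : slaterSpan B n N) :
    (slaterEquiv hB n N φ : 𝓢(Config N, ℂ)) = listDown B n (List.finRange N) φ.1 := rfl

/-- The raising product is the adjoint of the lowering product and undoes it on `φ`; nothing is
needed of `ψ`. -/
lemma inner_listDown_listDown (hB : 0 < B) {φ ψ : 𝓢(Config N, ℂ)}
    (hφ : ∀ i, φ ∈ particleLevel B n i) :
    ⟪toL2 _ (listDown B n (List.finRange N) φ), toL2 _ (listDown B n (List.finRange N) ψ)⟫_ℂ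
      = ⟪toL2 _ φ, toL2 _ ψ⟫_ℂ := by
  simp only [toL2_apply]
  rw [← inner_listUp_left (List.nodup_finRange N),
    listUp_listDown hB (List.nodup_finRange N) fun i _ => hφ i]

lemma norm_slaterEmbedding_slaterEquiv (hB : 0 < B) (hm : 0 < m) (φ : slaterSpan B n N) :
    ‖slaterEmbedding hB hm 0 N (slaterEquiv hB n N φ)‖ = ‖slaterEmbedding hB hm n N φ‖ := by
  rw [← Submodule.norm_coe, ← Submodule.norm_coe, coe_slaterEmbedding, coe_slaterEmbedding,
    coe_slaterEquiv, @norm_eq_sqrt_re_inner ℂ, @norm_eq_sqrt_re_inner ℂ,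
    inner_listDown_listDown hB fun i => slaterSpan_le_particleLevel i φ.2]

/-- The unitary map from the `n`-th to the lowest Landau level of `N` fermions. -/
def landauUnitary (hB : 0 < B) (hm : 0 < m) (n N : ℕ) :
    landauLevelN B m n N ≃ₗᵢ[ℂ] landauLevelN B m 0 N :=
  (slaterEquiv hB n N).extendOfIsometry (slaterEmbedding hB hm n N) (slaterEmbedding hB hm 0 N)
    (denseRange_slaterEmbedding hB hm) (denseRange_slaterEmbedding hB hm)
    (norm_slaterEmbedding_slaterEquiv hB hm)

lemma landauUnitary_slaterEmbedding (hB : 0 < B) (hm : 0 < m) (φ : slaterSpan B n N) :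
    landauUnitary hB hm n N (slaterEmbedding hB hm n N φ)
      = slaterEmbedding hB hm 0 N (slaterEquiv hB n N φ) :=
  LinearEquiv.extendOfIsometry_eq _ _ _ _ _ _ _

attribute [irreducible] landauUnitary

/-- The adjoint relation holds on the dense Slater span for every Schwartz `χ`, in the level or not,
and extends by continuity in `Φ`. -/
lemma inner_landauUnitary (hB : 0 < B) (hm : 0 < m) (χ : 𝓢(Config N, ℂ))
    (Φ : landauLevelN B m n N) :
    ⟪toL2 _ χ, (landauUnitary hB hm n N Φ : Lp ℂ 2 (volume : Measure (Config N)))⟫_ℂ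
      = ⟪toL2 _ (listUp B n (List.finRange N) χ), (Φ : Lp ℂ 2 (volume : Measure (Config N)))⟫_ℂ := by
  refine (denseRange_slaterEmbedding (n := n) (N := N) hB hm).induction_on Φ
    (isClosed_eq (by fun_prop) (by fun_prop)) fun φ => ?_
  rw [landauUnitary_slaterEmbedding]
  exact (inner_listUp_left (List.nodup_finRange N) χ φ.1).symm

lemma inner_listDown_landauUnitary (hB : 0 < B) (hm : 0 < m) (χ : 𝓢(Config N, ℂ))
    (Φ : landauLevelN B m n N) :
    ⟪toL2 _ (listDown B n (List.finRange N) χ),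
        (landauUnitary hB hm n N Φ : Lp ℂ 2 (volume : Measure (Config N)))⟫_ℂ
      = ⟪toL2 _ χ, (Φ : Lp ℂ 2 (volume : Measure (Config N)))⟫_ℂ := by
  refine (denseRange_slaterEmbedding (n := n) (N := N) hB hm).induction_on Φ
    (isClosed_eq (by fun_prop) (by fun_prop)) fun φ => ?_
  rw [landauUnitary_slaterEmbedding, coe_slaterEmbedding, coe_slaterEmbedding, coe_slaterEquiv,
    ← inner_conj_symm, inner_listDown_listDown hB fun i => slaterSpan_le_particleLevel i φ.2,
    inner_conj_symm]

/-- Here `φ` may lie outside the Slater span; the two sides agree because they have the same inner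
products with all Schwartz functions. -/
lemma toL2_listDown (hB : 0 < B) (hm : 0 < m) {φ : 𝓢(Config N, ℂ)} {Φ : landauLevelN B m n N}
    (h : toL2 _ φ = Φ) :
    toL2 _ (listDown B n (List.finRange N) φ) = landauUnitary hB hm n N Φ := by
  refine inner_toL2_ext fun χ => ?_
  rw [inner_landauUnitary, ← h]
  exact (inner_listUp_left (List.nodup_finRange N) χ φ).symm

lemma toL2_listUp (hB : 0 < B) (hm : 0 < m) {φ : 𝓢(Config N, ℂ)} {Φ : landauLevelN B m n N}
    (h : toL2 _ φ = landauUnitary hB hm n N Φ) :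
    toL2 _ (listUp B n (List.finRange N) φ) = Φ := by
  refine inner_toL2_ext fun χ => ?_
  rw [← inner_listDown_landauUnitary hB hm, ← h, ← inner_conj_symm]
  simp only [toL2_apply]
  rw [inner_listUp_left (List.nodup_finRange N), inner_conj_symm]

lemma landauUnitary_mem_schwartzStates_iff (hB : 0 < B) (hm : 0 < m) (Φ : landauLevelN B m n N) :
    landauUnitary hB hm n N Φ ∈ schwartzStates B m 0 N ↔ Φ ∈ schwartzStates B m n N :=
  ⟨fun ⟨_, h⟩ => ⟨_, toL2_listUp hB hm h⟩, fun ⟨_, h⟩ => ⟨_, toL2_listDown hB hm h⟩⟩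

lemma dense_schwartzStates (hB : 0 < B) (hm : 0 < m) : Dense (schwartzStates B m n N) :=
  (denseRange_slaterEmbedding hB hm).mono (by rintro _ ⟨φ, rfl⟩; exact ⟨φ.1, rfl⟩)

lemma landauUnitary_image_schwartzStates (hB : 0 < B) (hm : 0 < m) :
    landauUnitary hB hm n N '' schwartzStates B m n N = schwartzStates B m 0 N := by
  ext Φ
  constructor
  · rintro ⟨Ψ, hΨ, rfl⟩
    exact (landauUnitary_mem_schwartzStates_iff hB hm Ψ).mpr hΨ
  · obtain ⟨Ψ, rfl⟩ := (landauUnitary hB hm n N).surjective Φ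
    exact fun h => ⟨Ψ, (landauUnitary_mem_schwartzStates_iff hB hm Ψ).mp h, rfl⟩

end Unitary

/-! ### The effective Hamiltonians -/

section Effective

variable {B m : ℝ} {n N : ℕ}

/-- The kinetic energy acts on `ψ` as the scalar `Nε_n`, so the potential enters only through the
density. -/
lemma matrixElement_eq (hB : 0 < B) (Q : 𝓢'(Config N, ℂ)) {φ ψ : 𝓢(Config N, ℂ)}
    (hψ : ∀ i, ψ ∈ particleLevel B n i) :
    matrixElement B m Q φ ψ
      = (N * levelEnergy B m n : ℂ) * ⟪toL2 _ φ, toL2 _ ψ⟫_ℂ + Q (density φ ψ) := by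
  have h1 : (∑ i : Fin N, landauHamiltonian B m (i, 0) (i, 1) ψ)
      = (N * levelEnergy B m n : ℂ) • ψ := by
    rw [Finset.sum_congr rfl fun i _ => landauHamiltonian_of_mem hB (by simp) (hψ i)]
    simp [mul_smul, Nat.cast_smul_eq_nsmul]
  have h2 : matrixElement B m Q φ ψ
      = ((∑ i : Fin N, landauHamiltonian B m (i, 0) (i, 1) ψ : 𝓢(Config N, ℂ)) :
          𝓢'(Config N, ℂ)) (conjSchwartz φ) + Q (density φ ψ) := rfl
  rw [h2, h1, ← inner_smul_right, ← map_smul]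
  simp only [toL2_apply]
  rw [inner_toLp_eq_integral, SchwartzMap.integralCLM_apply]
  simp only [density_apply, SchwartzMap.smul_apply, smul_eq_mul, map_smul, mul_assoc,
    SchwartzMap.toTemperedDistributionCLM_apply_apply]
  simp [conjSchwartz_apply, integral_const_mul, mul_comm]

lemma matrixElement_sub (hB : 0 < B) {Q Q₀ : 𝓢'(Config N, ℂ)}
    (hQ : ∀ φ ψ : 𝓢(Config N, ℂ), (∀ i, φ ∈ particleLevel B n i) →
      (∀ i, ψ ∈ particleLevel B n i) → Q (density φ ψ) = Q₀ (density
        (listDown B n (List.finRange N) φ) (listDown B n (List.finRange N) ψ)))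
    {φ ψ : 𝓢(Config N, ℂ)} (hφ : ∀ i, φ ∈ particleLevel B n i)
    (hψ : ∀ i, ψ ∈ particleLevel B n i)
    (hψ₀ : ∀ i, listDown B n (List.finRange N) ψ ∈ particleLevel B 0 i) :
    matrixElement B m Q φ ψ - ((n * (B / m) * N : ℝ) : ℂ) * ⟪toL2 _ φ, toL2 _ ψ⟫_ℂ
      = matrixElement B m Q₀ (listDown B n (List.finRange N) φ)
          (listDown B n (List.finRange N) ψ) := by
  rw [matrixElement_eq hB Q hψ, matrixElement_eq hB Q₀ hψ₀, inner_listDown_listDown hB hφ,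
    hQ φ ψ hφ hψ]
  simp only [levelEnergy]
  push_cast
  ring

/-- The graph of the projected Hamiltonian before taking the closure. -/
def schwartzGraph (B m : ℝ) (n : ℕ) {N : ℕ} (Q : 𝓢'(Config N, ℂ)) :
    Set (landauLevelN B m n N × landauLevelN B m n N) :=
  {p | ∃ ψ : 𝓢(Config N, ℂ), ψ.toLp 2 = (p.1 : Lp ℂ 2 (volume : Measure (Config N))) ∧
    ∀ φ : 𝓢(Config N, ℂ), φ.toLp 2 volume ∈ landauLevelN B m n N →
      ⟪φ.toLp 2, (p.2 : Lp ℂ 2 (volume : Measure (Config N)))⟫_ℂ = matrixElement B m Q φ ψ}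

section GraphTransform

variable {H K : Type*} [NormedAddCommGroup H] [InnerProductSpace ℂ H] [NormedAddCommGroup K]
  [InnerProductSpace ℂ K] {E : Submodule ℂ H} {F : Submodule ℂ K}

/-- The map `(Ψ, Ξ) ↦ (U Ψ, U (Ξ - c Ψ))`. -/
def graphTransform (U : E ≃ₗᵢ[ℂ] F) (c : ℂ) : E × E ≃ₜ F × F where
  toFun p := (U p.1, U (p.2 - c • p.1))
  invFun q := (U.symm q.1, U.symm q.2 + c • U.symm q.1)
  left_inv p := by simp
  right_inv q := by simp
  continuous_toFun := by fun_prop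
  continuous_invFun := by fun_prop

/-- The map of graphs is a homeomorphism and commutes with closures, so the operator identity may be
checked before closing. -/
lemma mem_closure_iff_graphTransform (U : E ≃ₗᵢ[ℂ] F) (c : ℂ) {S : Set (E × E)} {T : Set (F × F)}
    (h : ∀ Ψ Ξ, (Ψ, Ξ) ∈ S ↔ (U Ψ, U (Ξ - c • Ψ)) ∈ T) (Ψ Ξ : E) :
    (Ψ, Ξ) ∈ closure S ↔ (U Ψ, U (Ξ - c • Ψ)) ∈ closure T := by
  have hS : S = graphTransform U c ⁻¹' T := Set.ext fun p => h p.1 p.2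
  rw [hS, ← Homeomorph.preimage_closure]
  rfl

lemma inner_graphTransform (U : E ≃ₗᵢ[ℂ] F) (c : ℂ) (Φ Ψ Ξ : E) :
    ⟪(U Φ : K), (U (Ξ - c • Ψ) : K)⟫_ℂ = ⟪(Φ : H), Ξ⟫_ℂ - c * ⟪Φ, Ψ⟫_ℂ := by
  rw [← Submodule.coe_inner, LinearIsometryEquiv.inner_map_map, inner_sub_right, inner_smul_right,
    Submodule.coe_inner]

end GraphTransform

/-- The unitary matches the Schwartz states of the two levels, hence also the test functions that
define the projection; what remains is the identity of matrix elements. -/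
lemma mem_schwartzGraph_iff (hB : 0 < B) (hm : 0 < m) {Q Q₀ : 𝓢'(Config N, ℂ)}
    (c : ℂ) (hQ : ∀ (Φ Ψ : landauLevelN B m n N) (φ ψ φ₀ ψ₀ : 𝓢(Config N, ℂ)),
      toL2 _ φ = Φ → toL2 _ ψ = Ψ →
      toL2 _ φ₀ = landauUnitary hB hm n N Φ → toL2 _ ψ₀ = landauUnitary hB hm n N Ψ →
      matrixElement B m Q φ ψ - c * ⟪Φ, Ψ⟫_ℂ = matrixElement B m Q₀ φ₀ ψ₀)
    (Ψ Ξ : landauLevelN B m n N) :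
    (Ψ, Ξ) ∈ schwartzGraph B m n Q ↔
      (landauUnitary hB hm n N Ψ, landauUnitary hB hm n N (Ξ - c • Ψ))
        ∈ schwartzGraph B m 0 Q₀ := by
  constructor
  · rintro ⟨ψ, hψ, h⟩
    have hψ : toL2 _ ψ = Ψ := hψ
    have h : ∀ φ, toL2 _ φ ∈ landauLevelN B m n N →
      ⟪toL2 _ φ, (Ξ : Lp ℂ 2 (volume : Measure (Config N)))⟫_ℂ = matrixElement B m Q φ ψ := h
    have hψ₀ := toL2_listDown hB hm hψ
    refine ⟨listDown B n (List.finRange N) ψ, hψ₀, fun φ₀ hφ₀ => ?_⟩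
    obtain ⟨Φ, hΦ⟩ := (landauUnitary hB hm n N).surjective ⟨toL2 _ φ₀, hφ₀⟩
    have hφ₀ : toL2 _ φ₀ = landauUnitary hB hm n N Φ := (congrArg Subtype.val hΦ).symm
    have hφ := toL2_listUp hB hm hφ₀
    have hmem : toL2 _ (listUp B n (List.finRange N) φ₀) ∈ landauLevelN B m n N := by
      rw [hφ]
      exact Φ.2
    have h1 := h _ hmem
    rw [hφ] at h1
    calc ⟪toL2 _ φ₀, (landauUnitary hB hm n N (Ξ - c • Ψ) :
          Lp ℂ 2 (volume : Measure (Config N)))⟫_ℂ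
        = ⟪(landauUnitary hB hm n N Φ : Lp ℂ 2 (volume : Measure (Config N))),
          (landauUnitary hB hm n N (Ξ - c • Ψ) : Lp ℂ 2 (volume : Measure (Config N)))⟫_ℂ :=
          congrArg (fun v => ⟪v, _⟫_ℂ) hφ₀
      _ = ⟪(Φ : Lp ℂ 2 (volume : Measure (Config N))), Ξ⟫_ℂ - c * ⟪Φ, Ψ⟫_ℂ :=
          inner_graphTransform (landauUnitary hB hm n N) c Φ Ψ Ξ
      _ = matrixElement B m Q _ ψ - c * ⟪Φ, Ψ⟫_ℂ := congrArg (· - c * ⟪Φ, Ψ⟫_ℂ) h1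
      _ = _ := hQ Φ Ψ _ ψ φ₀ _ hφ hψ hφ₀ hψ₀
  · rintro ⟨ψ₀, hψ₀, h⟩
    have hψ₀ : toL2 _ ψ₀ = landauUnitary hB hm n N Ψ := hψ₀
    have h : ∀ φ, toL2 _ φ ∈ landauLevelN B m 0 N →
      ⟪toL2 _ φ, (landauUnitary hB hm n N (Ξ - c • Ψ) : Lp ℂ 2 (volume : Measure (Config N)))⟫_ℂ
        = matrixElement B m Q₀ φ ψ₀ := h
    have hψ := toL2_listUp hB hm hψ₀
    refine ⟨listUp B n (List.finRange N) ψ₀, hψ, fun φ hφ => ?_⟩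
    obtain ⟨Φ, hΦ⟩ : ∃ Φ : landauLevelN B m n N, toL2 _ φ = Φ := ⟨⟨toL2 _ φ, hφ⟩, rfl⟩
    have hφ₀ := toL2_listDown hB hm hΦ
    have hmem : toL2 _ (listDown B n (List.finRange N) φ) ∈ landauLevelN B m 0 N := by
      rw [hφ₀]
      exact Subtype.prop _
    have h1 := h _ hmem
    rw [hφ₀] at h1
    have h2 : ⟪(Φ : Lp ℂ 2 (volume : Measure (Config N))), Ξ⟫_ℂ - c * ⟪Φ, Ψ⟫_ℂ
        = matrixElement B m Q φ _ - c * ⟪Φ, Ψ⟫_ℂ :=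
      (inner_graphTransform (landauUnitary hB hm n N) c Φ Ψ Ξ).symm.trans
        (h1.trans (hQ Φ Ψ φ _ _ ψ₀ hΦ hψ hφ₀ hψ₀).symm)
    exact (congrArg (fun v => ⟪v, (Ξ : Lp ℂ 2 (volume : Measure (Config N)))⟫_ℂ) hΦ).trans
      (sub_left_injective h2)

lemma transformsInto_of_density (hB : 0 < B) (hm : 0 < m) {Q Q₀ : 𝓢'(Config N, ℂ)}
    (hQ : ∀ φ ψ : 𝓢(Config N, ℂ), (∀ i, φ ∈ particleLevel B n i) →
      (∀ i, ψ ∈ particleLevel B n i) → Q (density φ ψ) = Q₀ (density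
        (listDown B n (List.finRange N) φ) (listDown B n (List.finRange N) ψ))) :
    TransformsInto (landauUnitary hB hm n N) (n * (B / m) * N) Q Q₀ := by
  have key : ∀ (Φ Ψ : landauLevelN B m n N) (φ ψ φ₀ ψ₀ : 𝓢(Config N, ℂ)),
      toL2 _ φ = Φ → toL2 _ ψ = Ψ →
      toL2 _ φ₀ = landauUnitary hB hm n N Φ → toL2 _ ψ₀ = landauUnitary hB hm n N Ψ →
      matrixElement B m Q φ ψ - ((n * (B / m) * N : ℝ) : ℂ) * ⟪Φ, Ψ⟫_ℂ
        = matrixElement B m Q₀ φ₀ ψ₀ := by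
    intro Φ Ψ φ ψ φ₀ ψ₀ hφ hψ hφ₀ hψ₀
    -- A Schwartz representative is determined by its `L²` class, so the given `φ₀` is the lowered
    -- `φ`.
    have h1 : φ₀ = listDown B n (List.finRange N) φ :=
      toL2_injective (hφ₀.trans (toL2_listDown hB hm hφ).symm)
    have h2 : ψ₀ = listDown B n (List.finRange N) ψ :=
      toL2_injective (hψ₀.trans (toL2_listDown hB hm hψ).symm)
    have h3 : toL2 _ ψ₀ ∈ landauLevelN B m 0 N := by rw [hψ₀]; exact Subtype.prop _
    have h4 : toL2 _ φ ∈ landauLevelN B m n N := by rw [hφ]; exact Φ.2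
    have h5 : toL2 _ ψ ∈ landauLevelN B m n N := by rw [hψ]; exact Ψ.2
    rw [Submodule.coe_inner, ← hφ, ← hψ, h1, h2]
    exact matrixElement_sub hB hQ (mem_particleLevel_of_toL2_mem hB hm h4)
      (mem_particleLevel_of_toL2_mem hB hm h5) (mem_particleLevel_of_toL2_mem hB hm (h2 ▸ h3))
  exact ⟨key, mem_closure_iff_graphTransform _ _ (mem_schwartzGraph_iff hB hm _ key)⟩

end Effective

end

end LandauLevels

theorem mainTheorem1 (B m : ℝ) (hB : 0 < B) (hm : 0 < m) (n N : ℕ) :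
    ∃ U : landauLevelN B m n N ≃ₗᵢ[ℂ] landauLevelN B m 0 N,
      Dense (schwartzStates B m n N) ∧
      U '' schwartzStates B m n N = schwartzStates B m 0 N ∧
      (∀ V w : 𝓢'(Plane, ℂ),
        TransformsInto U (n * (B / m) * N)
          (oneBody N V + twoBody N w)
          (oneBody N (laguerreLaplacian B n V) + twoBody N ((laguerreLaplacian B n ^ 2) w))) ∧
      (∀ (V : 𝓢'(Plane, ℂ)) (ℓ : ℕ) (W : 𝓢'(Config ℓ, ℂ)),
        TransformsInto U (n * (B / m) * N)
          (oneBody N V + manyBody N W)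
          (oneBody N (laguerreLaplacian B n V) + manyBody N (laguerreLaplacianProd B n ℓ W))) := by
  refine ⟨landauUnitary hB hm n N, dense_schwartzStates hB hm,
    landauUnitary_image_schwartzStates hB hm, fun V w => ?_, fun V ℓ W => ?_⟩
  · exact transformsInto_of_density hB hm fun φ ψ hφ hψ =>
      congrArg₂ (· + ·) (oneBody_density hB V hφ hψ) (twoBody_density hB w hφ hψ)
  · exact transformsInto_of_density hB hm fun φ ψ hφ hψ =>
      congrArg₂ (· + ·) (oneBody_density hB V hφ hψ) (manyBody_density hB W hφ hψ)
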